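/- Let $\beta\in(0,1)$, $\eta\ge 0$, $\kappa>0$ and $\gamma>\eta^2$. Consider on $[0,1]$ the boundary-eigenvalue problem, with eigenvalue parameter $\lambda\in\mathbb C$, $$w^{(4)}-(\gamma-\eta^2)w''+2\lambda\beta\eta w'+\lambda^2w=0,\qquad w(0)=w''(0)=0,$$ $$w''(1)+\lambda\kappa w'(1)=0,\qquad w^{(3)}(1)-(\gamma-\eta^2)w'(1)=0 .$$ An eigenvalue is a $\lambda$ for which there is a solution $w\not\equiv 0$ (an eigenfunction); it is called simple if its eigenfunctions are unique up to scalar factors and none of them has an associated function, i.e. a function $v$ with $v(0)=v''(0)=0$, $v^{(3)}(1)-(\gamma-\eta^2)v'(1)=0$, $v^{(4)}-(\gamma-\eta^2)v''+2\lambda\beta\eta v'+\lambda^2v+2\beta\eta w'+2\lambda w=0$ and $v''(1)+\lambda\kappa v'(1)+\kappa w'(1)=0$. Then there are $N\in\mathbb N$ and numbers $\rho_n\in\mathbb C$ such that, with $\lambda_n=i\rho_n^2$: 1. the numbers $\lambda_n,\overline{\lambda_n}$, $n\ge N$, are pairwise distinct simple eigenvalues with $\operatorname{Re}\lambda_n<0<\operatorname{Im}\lambda_n$,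 and the problem has only finitely many other eigenvalues; 2. as $n\to\infty$, $$\rho_n=\left(n+\tfrac12\right)\pi+\frac{\frac{\beta^2\eta^2}{2}+\gamma-\eta^2+2i\beta\eta+\frac{2i}{\kappa}}{4\left(n+\frac12\right)\pi}+O(n^{-2});$$ 3. as $n\to\infty$, $$\lambda_n=-\left(\beta\eta+\frac1\kappa\right)+i\left\{\left[\left(n+\tfrac12\right)\pi\right]^2+\frac{\frac{\beta^2\eta^2}{2}+\gamma-\eta^2}{2}\right\}+O(n^{-1}).$$ In particular $\operatorname{Re}\lambda_n\to-\left(\beta\eta+\frac1\kappa\right)<0$ and $\operatorname{Im}\lambda_n\to+\infty$, so that the large eigenvalues line up along a vertical asymptote in the open left half-plane. -/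

import Mathlib

open Set Filter Topology Asymptotics

namespace Tube

/-- The `k`-th derivative on the interval `[0,1]` (one-sided at the end points). -/
noncomputable abbrev D (k : ℕ) (w : ℝ → ℂ) (s : ℝ) : ℂ :=
  iteratedDerivWithin k w (Icc (0 : ℝ) 1) s

/-- The differential expression `w⁗ - (γ - η²) w″ + 2 z β η w′ + z² w` at `s`,
with eigenvalue parameter `z`. -/
noncomputable def diffExpr (β η γ : ℝ) (z : ℂ) (w : ℝ → ℂ) (s : ℝ) : ℂ :=
  D 4 w s - ((γ : ℂ) - (η : ℂ) ^ 2) * D 2 w s + 2 * z * (β : ℂ) * (η : ℂ) * D 1 w s + z ^ 2 * w s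

/-- The `z`-dependent boundary form `w″(1) + z κ w′(1)`. -/
noncomputable def feedbackForm (κ : ℝ) (z : ℂ) (w : ℝ → ℂ) : ℂ :=
  D 2 w 1 + z * (κ : ℂ) * D 1 w 1

/-- `w` is of class `C⁴` on `[0,1]` and satisfies the boundary conditions that do not involve the
eigenvalue parameter: `w(0) = w″(0) = 0` and `w‴(1) - (γ - η²) w′(1) = 0`. -/
structure InDomain (η γ : ℝ) (w : ℝ → ℂ) : Prop where
  contDiffOn : ContDiffOn ℝ 4 w (Icc (0 : ℝ) 1)
  zero_left : w 0 = 0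
  deriv_two_left : D 2 w 0 = 0
  shear_right : D 3 w 1 - ((γ : ℂ) - (η : ℂ) ^ 2) * D 1 w 1 = 0

/-- `w` is an eigenfunction of the boundary-eigenvalue problem at `z`: a solution of the
differential equation and of all boundary conditions that does not vanish identically on `[0,1]`. -/
structure IsEigenfunction (β η γ κ : ℝ) (z : ℂ) (w : ℝ → ℂ) : Prop where
  inDomain : InDomain η γ w
  equation : ∀ s ∈ Icc (0 : ℝ) 1, diffExpr β η γ z w s = 0
  feedback : feedbackForm κ z w = 0
  nontrivial : ∃ s ∈ Icc (0 : ℝ) 1, w s ≠ 0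

/-- `z` is an eigenvalue of the boundary-eigenvalue problem. -/
def IsEigenvalue (β η γ κ : ℝ) (z : ℂ) : Prop :=
  ∃ w : ℝ → ℂ, IsEigenfunction β η γ κ z w

/-- `v` is an associated function for the eigenfunction `w` at `z`, i.e. `w, v` is a chain of length
two: `L(z) v + L'(z) w = 0`, where `L(z)` consists of the differential expression and of the
`z`-dependent boundary form, and `L'(z)` is its derivative with respect to `z`. -/
structure IsAssociatedFunction (β η γ κ : ℝ) (z : ℂ) (w v : ℝ → ℂ) : Prop where
  inDomain : InDomain η γ v
  equation : ∀ s ∈ Icc (0 : ℝ) 1,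
    diffExpr β η γ z v s + (2 * (β : ℂ) * (η : ℂ) * D 1 w s + 2 * z * w s) = 0
  feedback : feedbackForm κ z v + (κ : ℂ) * D 1 w 1 = 0

/-- `z` is a simple eigenvalue (algebraic multiplicity one): the eigenfunctions at `z` are unique up
to a scalar factor on `[0,1]`, and no eigenfunction at `z` has an associated function. -/
structure IsSimpleEigenvalue (β η γ κ : ℝ) (z : ℂ) : Prop where
  isEigenvalue : IsEigenvalue β η γ κ z
  geometric : ∀ w v : ℝ → ℂ, IsEigenfunction β η γ κ z w → IsEigenfunction β η γ κ z v →
    ∃ c : ℂ, ∀ s ∈ Icc (0 : ℝ) 1, v s = c * w s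
  no_associated : ∀ w v : ℝ → ℂ, IsEigenfunction β η γ κ z w →
    ¬ IsAssociatedFunction β η γ κ z w v

/-- The number `(n + 1/2) π`. -/
noncomputable def freq (n : ℕ) : ℝ := ((n : ℝ) + 1 / 2) * Real.pi

end Tube

/-!
Write `b = βη` and `g = γ - η²`. In terms of the state `(w, w′, w″, w‴)` the differential equation is
the linear system `y' = A(z) y` with `A(z) = stateMatrix b g z`, so an eigenfunction is determined by
`(w′(0), w‴(0))`, and the two conditions at `1` give a `2 × 2` linear system for this pair, with
entries taken from `exp (A(z))`. Its determinant `charDet` is an entire function of `z` whose zeros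
are the eigenvalues (`isEigenvalue_iff`), and a simple zero is a simple eigenvalue
(`isSimpleEigenvalue_of_hasDerivAt`): if `w, v` is a chain of length two at `z`, then `w + t v` solves
the problem with parameter `z + t` up to `O(t²)`, so that the determinant is `O(t²)` at `z + t`.

The problem is real, so it suffices to look at `Im z ≥ 0`, that is, at `z = iρ²` with `ρ` in the sector
`|Im ρ| ≤ Re ρ`. For large `ρ` the characteristic exponents are `ρ u_j(1/ρ)`, where `u_j` are the
analytic branches of the roots of a quartic that start at `i, -i, 1, -1`. In the basis of exponentials
`charDet` becomes `A e^{ρ u₀} + B e^{ρ u₁}` plus exponentially small terms, up to a nonvanishing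
factor, where `A` and `B` are analytic in `1/ρ` and agree at `1/ρ = 0`. Two consequences follow.
Zeros in the sector lie in a fixed strip `|Im ρ| ≤ Y` (`IsRootBranch.exists_abs_im_le`), since
otherwise one of the two exponentials dominates. In such a strip the equation takes the form
`exp (2i (ρ - F ρ)) = -1` (`charDet_eq_charFactor_mul`), where `F = phase` is analytic and satisfies
`F ρ = q/ρ + O(ρ⁻²)`, `4q = b²/2 + g + 2ib + 2i/κ` (`isBigO_phase`); here `b²/2 + g` comes from the
second-order expansion of `u₀ - u₁`, and `2ib + 2i/κ` from the first-order expansion of `B/A`.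

Hence the large zeros are the solutions of `ρ = (n + 1/2)π + F ρ`. By Cauchy's estimate the right-hand
side is a contraction near `(n + 1/2)π`, which gives exactly one solution `ρ_n` there, the simplicity of
this zero, and, after one iteration, its asymptotics. The remaining eigenvalues are zeros of the
entire function `charDet` in a bounded disc, so there are finitely many of them.
-/

/-! ### The equation as a first-order system -/

namespace Tube

open Matrix

attribute [local instance] Matrix.linftyOpNormedRing Matrix.linftyOpNormedAlgebra

/-- The companion matrix of `w⁗ - g w″ + 2 z b w′ + z² w = 0`, acting on `(w, w′, w″, w‴)`. -/
noncomputable def stateMatrix (b g z : ℂ) : Matrix (Fin 4) (Fin 4) ℂ :=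
  !![0, 1, 0, 0; 0, 0, 1, 0; 0, 0, 0, 1; -z ^ 2, -(2 * z * b), g, 0]

theorem stateMatrix_mulVec (b g z : ℂ) (y : Fin 4 → ℂ) :
    stateMatrix b g z *ᵥ y =
      ![y 1, y 2, y 3, -z ^ 2 * y 0 - 2 * z * b * y 1 + g * y 2] := by
  ext i
  fin_cases i <;> simp [stateMatrix, Matrix.mulVec, dotProduct, Fin.sum_univ_succ]; ring

/-- The product of a matrix and a vector as a continuous bilinear map. -/
noncomputable def mulVecCLM (n : ℕ) :
    Matrix (Fin n) (Fin n) ℂ →L[ℝ] (Fin n → ℂ) →L[ℝ] (Fin n → ℂ) :=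
  LinearMap.mkContinuous₂ (Matrix.mulVecBilin ℝ ℝ) 1 fun A v => by
    simpa using Matrix.linfty_opNorm_mulVec A v

@[simp] theorem mulVecCLM_apply {n : ℕ} (A : Matrix (Fin n) (Fin n) ℂ) (v : Fin n → ℂ) :
    mulVecCLM n A v = A *ᵥ v := rfl

/-- Variation of constants: transporting `y` to the time `T` along the flow of `A` leaves only the
defect `y' - A y` in the derivative. -/
theorem hasDerivWithinAt_exp_sub_smul_mulVec {n : ℕ} (A : Matrix (Fin n) (Fin n) ℂ) (T : ℝ)
    {y : ℝ → Fin n → ℂ} {y' : Fin n → ℂ} {S : Set ℝ} {s : ℝ} (hy : HasDerivWithinAt y y' S s) :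
    HasDerivWithinAt (fun t => NormedSpace.exp ((T - t) • A) *ᵥ y t)
      (NormedSpace.exp ((T - s) • A) *ᵥ (y' - A *ᵥ y s)) S s := by
  have h1 : HasDerivAt (fun t : ℝ => NormedSpace.exp ((T - t) • A))
      (-(NormedSpace.exp ((T - s) • A) * A)) s := by
    have h := (hasDerivAt_exp_smul_const A (T - s)).scomp s ((hasDerivAt_id s).const_sub T)
    exact h.congr_deriv (by simp; rfl)
  have h2 := (mulVecCLM n).hasDerivWithinAt_of_bilinear (h1.hasDerivWithinAt (s := S)) hy
  refine h2.congr_deriv ?_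
  change NormedSpace.exp ((T - s) • A) *ᵥ y' + (-(NormedSpace.exp ((T - s) • A) * A)) *ᵥ y s = _
  rw [Matrix.mulVec_sub, Matrix.neg_mulVec, Matrix.mulVec_mulVec]
  exact (sub_eq_add_neg _ _).symm

theorem eq_exp_smul_mulVec {n : ℕ} {A : Matrix (Fin n) (Fin n) ℂ} {y : ℝ → Fin n → ℂ}
    (hy : ∀ s ∈ Icc (0 : ℝ) 1, HasDerivWithinAt y (A *ᵥ y s) (Icc 0 1) s) {T : ℝ}
    (hT : T ∈ Icc (0 : ℝ) 1) : y T = NormedSpace.exp (T • A) *ᵥ y 0 := by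
  have h := (convex_Icc (0 : ℝ) 1).norm_image_sub_le_of_norm_hasDerivWithin_le (C := 0)
    (fun s hs => hasDerivWithinAt_exp_sub_smul_mulVec A T (hy s hs)) (by simp)
    (by simp : (0 : ℝ) ∈ Icc (0 : ℝ) 1) hT
  simpa [sub_eq_zero] using h

theorem exp_mulVec_eigenvector {n : ℕ} {A : Matrix (Fin n) (Fin n) ℂ} {r : ℂ} {v : Fin n → ℂ}
    (h : A *ᵥ v = r • v) : NormedSpace.exp A *ᵥ v = Complex.exp r • v := by
  have key : ∀ s ∈ Icc (0 : ℝ) 1, HasDerivWithinAt (fun s : ℝ => Complex.exp (s * r) • v)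
      (A *ᵥ (Complex.exp (s * r) • v)) (Icc 0 1) s := by
    intro s _
    have h1 : HasDerivAt (fun s : ℝ => Complex.exp (s * r)) (Complex.exp (s * r) * r) s := by
      have := ((Complex.ofRealCLM.hasDerivAt (x := s)).mul_const r).cexp
      simpa using this
    refine ((h1.smul_const v).congr_deriv ?_).hasDerivWithinAt
    rw [Matrix.mulVec_smul, h, smul_smul]
  have := eq_exp_smul_mulVec key (T := 1) (by simp)
  simpa using this.symm

/-- The first-order state `(w, w′, w″, w‴)`. -/
noncomputable def state (w : ℝ → ℂ) (s : ℝ) : Fin 4 → ℂ := fun i => D i w s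

theorem hasDerivWithinAt_D {w : ℝ → ℂ} (hw : ContDiffOn ℝ 4 w (Icc (0 : ℝ) 1)) {k : ℕ} (hk : k < 4)
    {s : ℝ} (hs : s ∈ Icc (0 : ℝ) 1) :
    HasDerivWithinAt (D k w) (D (k + 1) w s) (Icc 0 1) s := by
  have h := (hw.differentiableOn_iteratedDerivWithin (m := k) (by exact_mod_cast hk)
    (uniqueDiffOn_Icc zero_lt_one)) s hs
  have h2 := h.hasDerivWithinAt
  rwa [← iteratedDerivWithin_succ] at h2

theorem hasDerivWithinAt_state {w : ℝ → ℂ} (hw : ContDiffOn ℝ 4 w (Icc (0 : ℝ) 1))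
    {s : ℝ} (hs : s ∈ Icc (0 : ℝ) 1) :
    HasDerivWithinAt (state w) (![D 1 w s, D 2 w s, D 3 w s, D 4 w s]) (Icc 0 1) s := by
  rw [hasDerivWithinAt_pi]
  intro i
  fin_cases i
  · exact hasDerivWithinAt_D hw (k := 0) (by norm_num) hs
  · exact hasDerivWithinAt_D hw (k := 1) (by norm_num) hs
  · exact hasDerivWithinAt_D hw (k := 2) (by norm_num) hs
  · exact hasDerivWithinAt_D hw (k := 3) (by norm_num) hs

/-- The first component of a trajectory of the linear system is a smooth function whose derivatives
are the other components. -/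
theorem contDiff_and_state_exp_smul_mulVec (b g z : ℂ) (c : Fin 4 → ℂ) :
    let w : ℝ → ℂ := fun s => (NormedSpace.exp (s • stateMatrix b g z) *ᵥ c) 0
    ContDiff ℝ 4 w ∧ ∀ s ∈ Icc (0 : ℝ) 1,
      state w s = NormedSpace.exp (s • stateMatrix b g z) *ᵥ c ∧
      D 4 w s = (stateMatrix b g z *ᵥ (NormedSpace.exp (s • stateMatrix b g z) *ᵥ c)) 3 := by
  intro w
  set A := stateMatrix b g z
  set y : ℝ → Fin 4 → ℂ := fun s => NormedSpace.exp (s • A) *ᵥ c with hy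
  have hd : ∀ s, HasDerivAt y (A *ᵥ y s) s := by
    intro s
    have h := (mulVecCLM 4).hasDerivAt_of_bilinear (x := s) (v := fun _ => c) (v' := 0)
      (fun _ => hasDerivAt_exp_smul_const' A s) (fun _ => hasDerivAt_const s c)
    refine h.congr_deriv ?_
    change NormedSpace.exp (s • A) *ᵥ 0 + (A * NormedSpace.exp (s • A)) *ᵥ c = _
    rw [Matrix.mulVec_zero, zero_add, hy, Matrix.mulVec_mulVec]
  have hA : ∀ (i : Fin 3) (s : ℝ), (A *ᵥ y s) i.castSucc = y s i.succ := by
    intro i s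
    rw [stateMatrix_mulVec]
    fin_cases i <;> rfl
  have hyc (i : Fin 4) : Continuous fun s => y s i := continuous_iff_continuousAt.2 fun s =>
    (hasDerivAt_pi.1 (hd s) i).continuousAt
  have hi : ∀ (i : Fin 4) s, HasDerivAt (fun s => y s i) ((A *ᵥ y s) i) s := fun i s =>
    hasDerivAt_pi.1 (hd s) i
  have d0 : iteratedDeriv 0 w = fun s => y s 0 := iteratedDeriv_zero
  have d1 : iteratedDeriv 1 w = fun s => y s 1 := by
    rw [iteratedDeriv_succ, d0]; ext s; rw [(hi 0 s).deriv]; exact hA 0 s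
  have d2 : iteratedDeriv 2 w = fun s => y s 2 := by
    rw [iteratedDeriv_succ, d1]; ext s; rw [(hi 1 s).deriv]; exact hA 1 s
  have d3 : iteratedDeriv 3 w = fun s => y s 3 := by
    rw [iteratedDeriv_succ, d2]; ext s; rw [(hi 2 s).deriv]; exact hA 2 s
  have d4 : iteratedDeriv 4 w = fun s => (A *ᵥ y s) 3 := by
    rw [iteratedDeriv_succ, d3]; ext s; rw [(hi 3 s).deriv]
  have hC : ContDiff ℝ 4 w := by
    refine (contDiff_nat_iff_iteratedDeriv (n := 4)).2 ⟨?_, ?_⟩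
    · intro m hm
      interval_cases m
      · rw [d0]; exact hyc _
      · rw [d1]; exact hyc _
      · rw [d2]; exact hyc _
      · rw [d3]; exact hyc _
      · rw [d4]
        simp only [A, stateMatrix_mulVec]
        simp only [Matrix.cons_val]
        have := hyc 0; have := hyc 1; have := hyc 2
        fun_prop
    · intro m hm
      interval_cases m
      · rw [d0]; exact fun s => (hi _ s).differentiableAt
      · rw [d1]; exact fun s => (hi _ s).differentiableAt
      · rw [d2]; exact fun s => (hi _ s).differentiableAt
      · rw [d3]; exact fun s => (hi _ s).differentiableAt
  have hD : ∀ k ≤ 4, ∀ s ∈ Icc (0 : ℝ) 1, D k w s = iteratedDeriv k w s := fun k hk s hs =>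
    iteratedDerivWithin_eq_iteratedDeriv (uniqueDiffOn_Icc zero_lt_one)
      ((hC.of_le (by exact_mod_cast hk)).contDiffAt) hs
  refine ⟨hC, fun s hs => ⟨?_, ?_⟩⟩
  · ext i
    fin_cases i
    · exact (hD 0 (by norm_num) s hs).trans (congrFun d0 s)
    · exact (hD 1 (by norm_num) s hs).trans (congrFun d1 s)
    · exact (hD 2 (by norm_num) s hs).trans (congrFun d2 s)
    · exact (hD 3 (by norm_num) s hs).trans (congrFun d3 s)
  · exact (hD 4 (by norm_num) s hs).trans (congrFun d4 s)

end Tube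

/-! ### The characteristic function -/

namespace Tube

open Matrix

attribute [local instance] Matrix.linftyOpNormedRing Matrix.linftyOpNormedAlgebra

/-- Coefficient, in `w‴(1) - g w′(1)`, of the `j`-th component of the state at `0`. -/
noncomputable def shearEntry (b g z : ℂ) (j : Fin 4) : ℂ :=
  NormedSpace.exp (stateMatrix b g z) 3 j - g * NormedSpace.exp (stateMatrix b g z) 1 j

/-- Coefficient, in `w″(1) + z k w′(1)`, of the `j`-th component of the state at `0`. -/
noncomputable def feedbackEntry (b g k z : ℂ) (j : Fin 4) : ℂ :=
  NormedSpace.exp (stateMatrix b g z) 2 j + z * k * NormedSpace.exp (stateMatrix b g z) 1 j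

/-- The characteristic function: the determinant of the conditions at `1` as equations for
`(w′(0), w‴(0))`, the other two components of the state at `0` being zero. -/
noncomputable def charDet (b g k z : ℂ) : ℂ :=
  shearEntry b g z 1 * feedbackEntry b g k z 3 - shearEntry b g z 3 * feedbackEntry b g k z 1

theorem differentiable_exp_stateMatrix (b g : ℂ) (i j : Fin 4) :
    Differentiable ℂ fun z => NormedSpace.exp (stateMatrix b g z) i j := by
  have hA : Differentiable ℂ (stateMatrix b g) := by
    have : stateMatrix b g = fun z => stateMatrix b g 0 +
        z • !![0, 0, 0, 0; 0, 0, 0, 0; 0, 0, 0, 0; 0, -(2 * b), 0, 0] +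
        z ^ 2 • !![0, 0, 0, 0; 0, 0, 0, 0; 0, 0, 0, 0; -1, 0, 0, 0] := by
      ext z i j
      fin_cases i <;> fin_cases j <;> simp [stateMatrix]
      ring
    rw [this]
    fun_prop
  have h1 : Differentiable ℂ fun z => NormedSpace.exp (stateMatrix b g z) := fun z =>
    (NormedSpace.exp_analytic (𝕂 := ℂ) (stateMatrix b g z)).differentiableAt.comp z (hA z)
  let L : Matrix (Fin 4) (Fin 4) ℂ →L[ℂ] ℂ :=
    LinearMap.toContinuousLinearMap (Matrix.entryLinearMap ℂ ℂ i j)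
  exact L.differentiable.comp h1

theorem differentiable_shearEntry (b g : ℂ) (j : Fin 4) :
    Differentiable ℂ fun z => shearEntry b g z j :=
  (differentiable_exp_stateMatrix b g 3 j).sub ((differentiable_exp_stateMatrix b g 1 j).const_mul g)

theorem differentiable_feedbackEntry (b g k : ℂ) (j : Fin 4) :
    Differentiable ℂ fun z => feedbackEntry b g k z j :=
  (differentiable_exp_stateMatrix b g 2 j).add
    ((differentiable_id.mul_const k).mul (differentiable_exp_stateMatrix b g 1 j))

theorem differentiable_charDet (b g k : ℂ) : Differentiable ℂ (charDet b g k) :=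
  ((differentiable_shearEntry b g 1).mul (differentiable_feedbackEntry b g k 3)).sub
    ((differentiable_shearEntry b g 3).mul (differentiable_feedbackEntry b g k 1))

theorem state_zero (w : ℝ → ℂ) (s : ℝ) : state w s 0 = w s :=
  congrFun iteratedDerivWithin_zero s

theorem state_eq_exp {β η γ : ℝ} {z : ℂ} {w : ℝ → ℂ} (hw : ContDiffOn ℝ 4 w (Icc (0 : ℝ) 1))
    (h : ∀ s ∈ Icc (0 : ℝ) 1, diffExpr β η γ z w s = 0) {s : ℝ} (hs : s ∈ Icc (0 : ℝ) 1) :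
    state w s =
      NormedSpace.exp (s • stateMatrix (β * η) (γ - η ^ 2) z) *ᵥ state w 0 := by
  refine eq_exp_smul_mulVec (fun s hs => ?_) hs
  refine (hasDerivWithinAt_state hw hs).congr_deriv ?_
  rw [stateMatrix_mulVec]
  have h1 := h s hs
  have h0 : state w s 0 = w s := state_zero w s
  have h2 : D 4 w s = -z ^ 2 * state w s 0 - 2 * z * (β * η) * state w s 1
      + (γ - η ^ 2) * state w s 2 := by
    rw [h0]; simp only [state, diffExpr] at h1 ⊢
    simp only [Fin.val_one, Fin.val_two]
    linear_combination h1
  rw [h2]; rfl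

theorem mulVec_of_hinged {E : Matrix (Fin 4) (Fin 4) ℂ} {c : Fin 4 → ℂ} (h0 : c 0 = 0)
    (h2 : c 2 = 0) (i : Fin 4) : (E *ᵥ c) i = E i 1 * c 1 + E i 3 * c 3 := by
  simp [Matrix.mulVec, dotProduct, Fin.sum_univ_four, h0, h2]

/-- The initial data `(w′(0), w‴(0))` of an eigenfunction lie in the kernel of the `2 × 2` matrix
whose determinant is `charDet`. -/
theorem IsEigenfunction.initial_data {β η γ κ : ℝ} {z : ℂ} {w : ℝ → ℂ}
    (h : IsEigenfunction β η γ κ z w) :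
    state w 0 0 = 0 ∧ state w 0 2 = 0 ∧
    shearEntry (β * η) (γ - η ^ 2) z 1 * state w 0 1 +
      shearEntry (β * η) (γ - η ^ 2) z 3 * state w 0 3 = 0 ∧
    feedbackEntry (β * η) (γ - η ^ 2) κ z 1 * state w 0 1 +
      feedbackEntry (β * η) (γ - η ^ 2) κ z 3 * state w 0 3 = 0 ∧
    (state w 0 1 ≠ 0 ∨ state w 0 3 ≠ 0) := by
  have h0 : state w 0 0 = 0 := (state_zero w 0).trans h.inDomain.zero_left
  have h2 : state w 0 2 = 0 := h.inDomain.deriv_two_left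
  have hs := fun s (hs : s ∈ Icc (0 : ℝ) 1) => state_eq_exp h.inDomain.contDiffOn h.equation hs
  have h1 (i : Fin 4) := congrFun (hs 1 (by simp)) i
  simp only [one_smul, mulVec_of_hinged h0 h2] at h1
  refine ⟨h0, h2, ?_, ?_, ?_⟩
  · have e : state w 1 3 - (γ - η ^ 2) * state w 1 1 = 0 := h.inDomain.shear_right
    rw [h1 3, h1 1] at e
    unfold shearEntry
    linear_combination e
  · have e : state w 1 2 + z * κ * state w 1 1 = 0 := h.feedback
    rw [h1 2, h1 1] at e
    unfold feedbackEntry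
    linear_combination e
  · by_contra! hc
    obtain ⟨s, hs', hne⟩ := h.nontrivial
    apply hne
    have hz : state w 0 = 0 := by
      ext i; fin_cases i
      exacts [h0, hc.1, h2, hc.2]
    have := congrFun (hs s hs') 0
    rw [hz, state_zero] at this
    simpa using this

/-- The eigenvalues are the zeros of the characteristic function. -/
theorem isEigenvalue_iff {β η γ κ : ℝ} {z : ℂ} :
    IsEigenvalue β η γ κ z ↔ charDet (β * η) (γ - η ^ 2) κ z = 0 := by
  constructor
  · rintro ⟨w, hw⟩
    obtain ⟨-, -, e1, e2, h | h⟩ := hw.initial_data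
    · refine (mul_eq_zero.1 (?_ : _ * state w 0 1 = 0)).resolve_right h
      unfold charDet
      linear_combination feedbackEntry (β * η) (γ - η ^ 2) κ z 3 * e1 -
        shearEntry (β * η) (γ - η ^ 2) z 3 * e2
    · refine (mul_eq_zero.1 (?_ : _ * state w 0 3 = 0)).resolve_right h
      unfold charDet
      linear_combination shearEntry (β * η) (γ - η ^ 2) z 1 * e2 -
        feedbackEntry (β * η) (γ - η ^ 2) κ z 1 * e1
  · intro h
    set p := shearEntry (β * η) (γ - η ^ 2) z with hp
    set q := feedbackEntry (β * η) (γ - η ^ 2) κ z with hq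
    have hdet : p 1 * q 3 - p 3 * q 1 = 0 := h
    obtain ⟨c1, c3, hc, e1, e2⟩ : ∃ c1 c3 : ℂ, (c1 ≠ 0 ∨ c3 ≠ 0) ∧ p 1 * c1 + p 3 * c3 = 0 ∧
        q 1 * c1 + q 3 * c3 = 0 := by
      by_cases hp1 : p 1 = 0 ∧ p 3 = 0
      · by_cases hq1 : q 1 = 0 ∧ q 3 = 0
        · exact ⟨1, 0, by simp, by simp [hp1], by simp [hq1]⟩
        · refine ⟨q 3, -q 1, ?_, by simp [hp1], by ring⟩
          by_contra! hh
          exact hq1 ⟨by simpa using hh.2, hh.1⟩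
      · refine ⟨p 3, -p 1, ?_, by ring, by linear_combination -hdet⟩
        by_contra! hh
        exact hp1 ⟨by simpa using hh.2, hh.1⟩
    set c : Fin 4 → ℂ := ![0, c1, 0, c3] with hcdef
    set A := stateMatrix (β * η) (γ - η ^ 2) z with hA
    obtain ⟨hC, hst⟩ := contDiff_and_state_exp_smul_mulVec (β * η) (γ - η ^ 2) z c
    set w : ℝ → ℂ := fun s => (NormedSpace.exp (s • A) *ᵥ c) 0 with hw
    have hs0 : state w 0 = c := by
      rw [(hst 0 (by simp)).1]; simp
    have hs1 (i : Fin 4) : state w 1 i =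
        NormedSpace.exp A i 1 * c1 + NormedSpace.exp A i 3 * c3 := by
      rw [(hst 1 (by simp)).1, one_smul, mulVec_of_hinged (by rfl) (by rfl)]; rfl
    have heq : ∀ s ∈ Icc (0 : ℝ) 1, diffExpr β η γ z w s = 0 := by
      intro s hs
      obtain ⟨e, e4⟩ := hst s hs
      rw [← e, stateMatrix_mulVec] at e4
      have e4' : D 4 w s = -z ^ 2 * state w s 0 - 2 * z * (β * η) * state w s 1
        + (γ - η ^ 2) * state w s 2 := e4
      have h0 : state w s 0 = w s := state_zero w s
      have h1 : state w s 1 = D 1 w s := rfl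
      have h2 : state w s 2 = D 2 w s := rfl
      rw [h0, h1, h2] at e4'
      unfold diffExpr
      linear_combination e4'
    refine ⟨w, ⟨hC.contDiffOn, ?_, ?_, ?_⟩, heq, ?_, ?_⟩
    · exact (state_zero w 0).symm.trans (congrFun hs0 0)
    · exact congrFun hs0 2
    · change state w 1 3 - (γ - η ^ 2) * state w 1 1 = 0
      rw [hs1, hs1]
      simp only [hp, shearEntry] at e1
      linear_combination e1
    · change state w 1 2 + z * κ * state w 1 1 = 0
      rw [hs1, hs1]
      simp only [hq, feedbackEntry] at e2
      linear_combination e2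
    · by_contra! hz
      have hz' : ∀ k, ∀ s ∈ Icc (0 : ℝ) 1, D k w s = 0 := by
        intro k s hs
        have : EqOn w (fun _ => 0) (Icc (0 : ℝ) 1) := hz
        rw [D, iteratedDerivWithin_congr this hs]
        simp
      have h1 : c1 = 0 := (congrFun hs0 1).symm.trans (hz' 1 0 (by simp))
      have h3 : c3 = 0 := (congrFun hs0 3).symm.trans (hz' 3 0 (by simp))
      simp [h1, h3] at hc

end Tube

/-! ### Simple zeros give simple eigenvalues -/

namespace Tube

open Matrix

attribute [local instance] Matrix.linftyOpNormedRing Matrix.linftyOpNormedAlgebra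

/-- For a chain `w, v` at `z`, the curve `w + t v` solves the equation with parameter `z + t` up to
an error that is quadratic in `t`. -/
theorem exists_norm_chain_sub_exp_le {β η γ : ℝ} {z : ℂ} {w v : ℝ → ℂ}
    (hw : ContDiffOn ℝ 4 w (Icc (0 : ℝ) 1)) (hv : ContDiffOn ℝ 4 v (Icc (0 : ℝ) 1))
    (ew : ∀ s ∈ Icc (0 : ℝ) 1, diffExpr β η γ z w s = 0)
    (ev : ∀ s ∈ Icc (0 : ℝ) 1,
      diffExpr β η γ z v s + (2 * (β : ℂ) * (η : ℂ) * D 1 w s + 2 * z * w s) = 0) :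
    ∃ C : ℝ, ∀ t : ℂ, ‖t‖ ≤ 1 → ‖(state w 1 + t • state v 1) -
      NormedSpace.exp (stateMatrix (β * η) (γ - η ^ 2) (z + t)) *ᵥ (state w 0 + t • state v 0)‖
        ≤ C * ‖t‖ ^ 2 := by
  set A : ℂ → Matrix (Fin 4) (Fin 4) ℂ := fun t => stateMatrix (β * η) (γ - η ^ 2) (z + t) with hA
  set f : ℂ × ℝ → Fin 4 → ℂ := fun p =>
    ![0, 0, 0, w p.2 + (2 * z + p.1) * v p.2 + 2 * (β * η) * D 1 v p.2] with hf
  set F : ℂ × ℝ → Fin 4 → ℂ := fun p => NormedSpace.exp ((1 - p.2) • A p.1) *ᵥ f p with hF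
  have hAc : Continuous A := by
    refine continuous_matrix fun i j => ?_
    fin_cases i <;> fin_cases j <;> simp [hA, stateMatrix] <;> fun_prop
  have hfst : ContinuousOn f (Metric.closedBall 0 1 ×ˢ Icc 0 1) := by
    have h1 : ContinuousOn (D 1 v) (Icc 0 1) := hv.continuousOn_iteratedDerivWithin (by norm_num)
      (uniqueDiffOn_Icc zero_lt_one)
    have h2 := hw.continuousOn
    have h3 := hv.continuousOn
    have hm : MapsTo Prod.snd (Metric.closedBall (0 : ℂ) 1 ×ˢ Icc (0 : ℝ) 1) (Icc 0 1) :=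
      fun p hp => hp.2
    have h1' := h1.comp continuousOn_snd hm
    have h2' := h2.comp continuousOn_snd hm
    have h3' := h3.comp continuousOn_snd hm
    refine continuousOn_pi.2 fun i => ?_
    fin_cases i
    · exact continuousOn_const
    · exact continuousOn_const
    · exact continuousOn_const
    · exact (h2'.add ((continuousOn_const.add continuousOn_fst).mul h3')).add
        (continuousOn_const.mul h1')
  have hexp : Continuous fun p : ℂ × ℝ => NormedSpace.exp ((1 - p.2) • A p.1) :=
    (NormedSpace.exp_continuous (𝔸 := Matrix (Fin 4) (Fin 4) ℂ)).comp
      (((continuous_const.sub continuous_snd)).smul (hAc.comp continuous_fst))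
  have hFc : ContinuousOn F (Metric.closedBall 0 1 ×ˢ Icc 0 1) := by
    rw [continuousOn_iff_continuous_domRestrict] at hfst ⊢
    exact (hexp.comp continuous_subtype_val).matrix_mulVec hfst
  obtain ⟨C, hC⟩ := ((isCompact_closedBall (0 : ℂ) 1).prod isCompact_Icc).exists_bound_of_continuousOn
    hFc
  refine ⟨C, fun t ht => ?_⟩
  have hd : ∀ s ∈ Icc (0 : ℝ) 1, HasDerivWithinAt
      (fun s => NormedSpace.exp ((1 - s) • A t) *ᵥ (state w s + t • state v s))
      (t ^ 2 • F (t, s)) (Icc 0 1) s := by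
    intro s hs
    refine (hasDerivWithinAt_exp_sub_smul_mulVec (A t) 1
      ((hasDerivWithinAt_state hw hs).add ((hasDerivWithinAt_state hv hs).const_smul t))).congr_deriv ?_
    rw [hF, ← Matrix.mulVec_smul]
    congr 1
    have e1 := ew s hs
    have e2 := ev s hs
    simp only [diffExpr] at e1 e2
    have hu0 := state_zero w s
    have hv0 := state_zero v s
    simp only [hA, hf, stateMatrix_mulVec]
    ext i
    fin_cases i
    · simp [state]
    · simp [state]
    · simp [state]
    · simp [hu0, hv0]
      simp only [state, Fin.val_one, Fin.val_two]
      linear_combination e1 + t * e2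
  have := (convex_Icc (0 : ℝ) 1).norm_image_sub_le_of_norm_hasDerivWithin_le (C := C * ‖t‖ ^ 2)
    hd (fun s hs => ?_) (by simp : (0 : ℝ) ∈ Icc (0 : ℝ) 1) (by simp : (1 : ℝ) ∈ Icc (0 : ℝ) 1)
  · simpa using this
  · rw [norm_smul, norm_pow, mul_comm]
    exact mul_le_mul_of_nonneg_right (hC (t, s) ⟨by simpa using ht, hs⟩) (by positivity)

/-- An eigenvalue at which the characteristic function has a simple zero is simple. -/
theorem isSimpleEigenvalue_of_hasDerivAt {β η γ κ : ℝ} {z d : ℂ}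
    (h0 : charDet (β * η) (γ - η ^ 2) κ z = 0)
    (hd : HasDerivAt (charDet (β * η) (γ - η ^ 2) κ) d z) (hd0 : d ≠ 0) :
    IsSimpleEigenvalue β η γ κ z := by
  set p := shearEntry (β * η) (γ - η ^ 2) with hp
  set q := feedbackEntry (β * η) (γ - η ^ 2) κ with hq
  have hpd (j : Fin 4) : Differentiable ℂ fun z => p z j := differentiable_shearEntry _ _ j
  have hqd (j : Fin 4) : Differentiable ℂ fun z => q z j := differentiable_feedbackEntry _ _ _ j
  refine ⟨isEigenvalue_iff.2 h0, fun w v hw hv => ?_, fun w v hw hv => hd0 ?_⟩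
  · obtain ⟨w0, w2, e1, e2, hne⟩ := hw.initial_data
    obtain ⟨v0, v2, f1, f2, -⟩ := hv.initial_data
    set c := state w 0
    set e := state v 0
    -- independent initial data would make all four matrix entries vanish, so that the determinant
    -- had a double zero
    have hdet : c 1 * e 3 - c 3 * e 1 = 0 := by
      by_contra hdet
      have hp1 : p z 1 = 0 := by
        refine (mul_eq_zero.1 (?_ : p z 1 * (c 1 * e 3 - c 3 * e 1) = 0)).resolve_right hdet
        linear_combination e 3 * e1 - c 3 * f1
      have hp3 : p z 3 = 0 := by
        refine (mul_eq_zero.1 (?_ : p z 3 * (c 1 * e 3 - c 3 * e 1) = 0)).resolve_right hdet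
        linear_combination c 1 * f1 - e 1 * e1
      have hq1 : q z 1 = 0 := by
        refine (mul_eq_zero.1 (?_ : q z 1 * (c 1 * e 3 - c 3 * e 1) = 0)).resolve_right hdet
        linear_combination e 3 * e2 - c 3 * f2
      have hq3 : q z 3 = 0 := by
        refine (mul_eq_zero.1 (?_ : q z 3 * (c 1 * e 3 - c 3 * e 1) = 0)).resolve_right hdet
        linear_combination c 1 * f2 - e 1 * e2
      have hd' := (((hpd 1 z).hasDerivAt).mul ((hqd 3 z).hasDerivAt)).sub
        (((hpd 3 z).hasDerivAt).mul ((hqd 1 z).hasDerivAt))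
      refine hd0 (hd.unique (hd'.congr_deriv ?_))
      simp [hp1, hp3, hq1, hq3]
    obtain ⟨m, hm1, hm3⟩ : ∃ m : ℂ, e 1 = m * c 1 ∧ e 3 = m * c 3 := by
      rcases hne with h | h
      · refine ⟨e 1 / c 1, by field_simp, ?_⟩
        field_simp
        linear_combination hdet
      · refine ⟨e 3 / c 3, ?_, by field_simp⟩
        field_simp
        linear_combination -hdet
    have he : e = m • c := by
      ext i; fin_cases i
      · simp [w0, v0]
      · simpa using hm1
      · simp [w2, v2]
      · simpa using hm3
    refine ⟨m, fun s hs => ?_⟩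
    have h1 := congrFun (state_eq_exp hw.inDomain.contDiffOn hw.equation hs) 0
    have h2 := congrFun (state_eq_exp hv.inDomain.contDiffOn hv.equation hs) 0
    change _ = (_ *ᵥ e) 0 at h2
    rw [he, Matrix.mulVec_smul, Pi.smul_apply, ← h1, state_zero, state_zero] at h2
    simpa using h2
  · obtain ⟨w0, w2, -, -, hne⟩ := hw.initial_data
    have v0 : state v 0 0 = 0 := (state_zero v 0).trans hv.inDomain.zero_left
    have v2 : state v 0 2 = 0 := hv.inDomain.deriv_two_left
    obtain ⟨C, hC⟩ := exists_norm_chain_sub_exp_le hw.inDomain.contDiffOn hv.inDomain.contDiffOn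
      hw.equation hv.equation
    set c := state w 0
    set e := state v 0
    set U : ℂ → Fin 4 → ℂ := fun t =>
      NormedSpace.exp (stateMatrix (β * η) (γ - η ^ 2) (z + t)) *ᵥ (c + t • e) with hU
    set err : ℂ → Fin 4 → ℂ := fun t => (state w 1 + t • state v 1) - U t with herr
    have hball : ∀ᶠ t : ℂ in 𝓝 0, ‖t‖ ≤ 1 := by
      filter_upwards [Metric.closedBall_mem_nhds (0 : ℂ) one_pos] with t ht
      simpa using ht
    have hO (i : Fin 4) : (fun t => err t i) =O[𝓝 0] fun t : ℂ => t ^ 2 := by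
      refine IsBigO.of_bound C ?_
      filter_upwards [hball] with t ht
      rw [norm_pow]
      exact (norm_le_pi_norm _ i).trans (hC t ht)
    have hUi (t : ℂ) (i : Fin 4) : U t i =
        NormedSpace.exp (stateMatrix (β * η) (γ - η ^ 2) (z + t)) i 1 * (c 1 + t * e 1) +
        NormedSpace.exp (stateMatrix (β * η) (γ - η ^ 2) (z + t)) i 3 * (c 3 + t * e 3) := by
      rw [hU]
      simp only
      rw [mulVec_of_hinged (by simp [w0, v0]) (by simp [w2, v2])]
      simp
    have herri (t : ℂ) (i : Fin 4) : err t i = state w 1 i + t * state v 1 i - U t i := by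
      simp [herr]
    have b1 : state w 1 3 - (γ - η ^ 2) * state w 1 1 = 0 := hw.inDomain.shear_right
    have b2 : state v 1 3 - (γ - η ^ 2) * state v 1 1 = 0 := hv.inDomain.shear_right
    have b3 : state w 1 2 + z * κ * state w 1 1 = 0 := hw.feedback
    have b4 : state v 1 2 + z * κ * state v 1 1 + κ * state w 1 1 = 0 := hv.feedback
    have hr1 (t : ℂ) : p (z + t) 1 * (c 1 + t * e 1) + p (z + t) 3 * (c 3 + t * e 3) =
        -err t 3 + (γ - η ^ 2) * err t 1 := by
      rw [herri, herri, hUi, hUi]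
      simp only [hp, shearEntry]
      linear_combination b1 + t * b2
    have hr2 (t : ℂ) : q (z + t) 1 * (c 1 + t * e 1) + q (z + t) 3 * (c 3 + t * e 3) =
        -err t 2 - (z + t) * κ * err t 1 + t ^ 2 * (κ * state v 1 1) := by
      rw [herri, herri, hUi, hUi]
      simp only [hq, feedbackEntry]
      linear_combination b3 + t * b4
    have hO1 : (fun t => p (z + t) 1 * (c 1 + t * e 1) + p (z + t) 3 * (c 3 + t * e 3))
        =O[𝓝 0] fun t : ℂ => t ^ 2 := by
      simp only [hr1]
      exact (hO 3).neg_left.add ((hO 1).const_mul_left _)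
    have hcont {f : ℂ → ℂ} (hf : Continuous f) : (fun t => f (z + t)) =O[𝓝 0] fun _ : ℂ => (1 : ℂ) :=
      (hf.comp (continuous_const.add continuous_id)).continuousAt.isBigO_one ℂ
    have hmul {f h : ℂ → ℂ} (hf : Continuous f) (hh : h =O[𝓝 0] fun t : ℂ => t ^ 2) :
        (fun t => f (z + t) * h t) =O[𝓝 0] fun t : ℂ => t ^ 2 := by
      simpa using (hcont hf).mul hh
    have hO2 : (fun t => q (z + t) 1 * (c 1 + t * e 1) + q (z + t) 3 * (c 3 + t * e 3))
        =O[𝓝 0] fun t : ℂ => t ^ 2 := by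
      simp only [hr2]
      refine ((hO 2).neg_left.sub (hmul (f := fun u => u * κ) (by fun_prop) (hO 1))).add ?_
      simpa using (isBigO_refl (fun t : ℂ => t ^ 2) (𝓝 0)).mul
        (isBigO_refl (fun _ : ℂ => (κ : ℂ) * state v 1 1) (𝓝 0) |>.trans
          (isBigO_const_const _ (one_ne_zero (α := ℂ)) _))
    -- a function that is quadratically small at `0` has derivative `0` there
    have key (i : Fin 4) (h : (fun t => charDet (β * η) (γ - η ^ 2) κ (z + t) * (c i + t * e i))
        =O[𝓝 0] fun t : ℂ => t ^ 2) : d * c i = 0 := by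
      have hz : HasDerivAt (fun t => charDet (β * η) (γ - η ^ 2) κ (z + t) * (c i + t * e i)) 0 0 := by
        rw [hasDerivAt_iff_isLittleO]
        simp only [add_zero, h0, zero_mul, sub_zero, smul_zero]
        refine h.trans_isLittleO ?_
        simpa using isLittleO_pow_id (𝕜 := ℂ) (n := 2) one_lt_two
      have h1 : HasDerivAt (fun t => charDet (β * η) (γ - η ^ 2) κ (z + t)) d 0 := by
        have := HasDerivAt.comp_const_add z 0 (by simpa using hd)
        simpa using this
      have h2 : HasDerivAt (fun t => c i + t * e i) (e i) 0 := by
        simpa using ((hasDerivAt_id (0 : ℂ)).mul_const (e i)).const_add (c i)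
      have h3 := hz.unique (h1.mul h2)
      simpa [h0] using h3.symm
    -- Cramer's rule
    have k1 : d * c 1 = 0 := by
      refine key 1 (((hmul (hqd 3).continuous hO1).sub (hmul (hpd 3).continuous hO2)).congr_left ?_)
      intro t
      simp only [charDet]
      ring
    have k3 : d * c 3 = 0 := by
      refine key 3 (((hmul (hpd 1).continuous hO2).sub (hmul (hqd 1).continuous hO1)).congr_left ?_)
      intro t
      simp only [charDet]
      ring
    rcases hne with h | h
    · exact (mul_eq_zero.1 k1).resolve_right h
    · exact (mul_eq_zero.1 k3).resolve_right h

/-! ### Complex conjugation -/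

theorem D_conj (k : ℕ) (w : ℝ → ℂ) {s : ℝ} (hs : s ∈ Icc (0 : ℝ) 1) :
    D k (fun x => starRingEnd ℂ (w x)) s = starRingEnd ℂ (D k w s) := by
  have h := Complex.conjCLE.iteratedFDerivWithin_comp_left w (uniqueDiffOn_Icc (zero_lt_one' ℝ)) hs k
  simp only [D, iteratedDerivWithin]
  change (iteratedFDerivWithin ℝ k (Complex.conjCLE ∘ w) (Icc 0 1) s) _ = _
  rw [h]
  simp

theorem InDomain.conj {η γ : ℝ} {w : ℝ → ℂ} (h : InDomain η γ w) :
    InDomain η γ fun s => starRingEnd ℂ (w s) := by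
  refine ⟨Complex.conjCLE.contDiff.comp_contDiffOn h.contDiffOn, by simp [h.zero_left], ?_, ?_⟩
  · rw [D_conj _ _ (by simp), h.deriv_two_left, map_zero]
  · rw [D_conj _ _ (by simp), D_conj _ _ (by simp)]
    simpa using congrArg (starRingEnd ℂ) h.shear_right

theorem IsEigenfunction.conj {β η γ κ : ℝ} {z : ℂ} {w : ℝ → ℂ} (h : IsEigenfunction β η γ κ z w) :
    IsEigenfunction β η γ κ (starRingEnd ℂ z) fun s => starRingEnd ℂ (w s) := by
  refine ⟨h.inDomain.conj, fun s hs => ?_, ?_, ?_⟩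
  · have := congrArg (starRingEnd ℂ) (h.equation s hs)
    simp only [diffExpr, D_conj _ _ hs] at this ⊢
    simpa [Complex.conj_ofNat] using this
  · have := congrArg (starRingEnd ℂ) h.feedback
    simp only [feedbackForm] at this ⊢
    rw [D_conj _ _ (by simp), D_conj _ _ (by simp)]
    simpa using this
  · obtain ⟨s, hs, hne⟩ := h.nontrivial
    exact ⟨s, hs, by simpa using hne⟩

theorem IsAssociatedFunction.conj {β η γ κ : ℝ} {z : ℂ} {w v : ℝ → ℂ}
    (h : IsAssociatedFunction β η γ κ z w v) :
    IsAssociatedFunction β η γ κ (starRingEnd ℂ z) (fun s => starRingEnd ℂ (w s))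
      fun s => starRingEnd ℂ (v s) := by
  refine ⟨h.inDomain.conj, fun s hs => ?_, ?_⟩
  · have := congrArg (starRingEnd ℂ) (h.equation s hs)
    simp only [diffExpr, D_conj _ _ hs] at this ⊢
    simpa [Complex.conj_ofNat] using this
  · have := congrArg (starRingEnd ℂ) h.feedback
    simp only [feedbackForm] at this ⊢
    rw [D_conj _ _ (by simp), D_conj _ _ (by simp), D_conj _ _ (by simp)]
    simpa using this

theorem IsEigenvalue.conj {β η γ κ : ℝ} {z : ℂ} (h : IsEigenvalue β η γ κ z) :
    IsEigenvalue β η γ κ (starRingEnd ℂ z) :=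
  let ⟨_, hw⟩ := h
  ⟨_, hw.conj⟩

theorem IsSimpleEigenvalue.conj {β η γ κ : ℝ} {z : ℂ} (h : IsSimpleEigenvalue β η γ κ z) :
    IsSimpleEigenvalue β η γ κ (starRingEnd ℂ z) := by
  refine ⟨h.isEigenvalue.conj, fun w v hw hv => ?_, fun w v hw hv => ?_⟩
  · have hw' := hw.conj
    have hv' := hv.conj
    rw [Complex.conj_conj] at hw' hv'
    obtain ⟨c, hc⟩ := h.geometric _ _ hw' hv'
    refine ⟨starRingEnd ℂ c, fun s hs => ?_⟩
    simpa using congrArg (starRingEnd ℂ) (hc s hs)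
  · have hw' := hw.conj
    have hv' := hv.conj
    rw [Complex.conj_conj] at hw' hv'
    exact h.no_associated _ _ hw' hv'

end Tube

/-! ### The scaled characteristic exponents -/

namespace Tube

open Matrix

/-- The characteristic polynomial of the differential equation for `z = i ρ²`, in the scaled
exponent `u = r / ρ`, with `x = 1 / ρ`. -/
noncomputable def quartic (b g x u : ℂ) : ℂ :=
  u ^ 4 - g * x ^ 2 * u ^ 2 + 2 * Complex.I * b * x * u - 1

/-- The four roots `i, -i, 1, -1` of `quartic` at `x = 0`. -/
noncomputable def unitRoot : Fin 4 → ℂ := ![Complex.I, -Complex.I, 1, -1]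

theorem unitRoot_pow_four (j : Fin 4) : unitRoot j ^ 4 = 1 := by
  fin_cases j
  · exact Complex.I_pow_four
  · exact (Even.neg_pow (by decide) _).trans Complex.I_pow_four
  · exact one_pow 4
  · exact (Even.neg_pow (by decide) _).trans (one_pow 4)

/-- The roots of the quartic at `x = 0` are simple, so the implicit function theorem applies. -/
theorem exists_analyticAt_quartic_eq_zero (b g : ℂ) {u₀ : ℂ} (hu : u₀ ^ 4 = 1) :
    ∃ u : ℂ → ℂ, AnalyticAt ℂ u 0 ∧ u 0 = u₀ ∧ ∀ᶠ x in 𝓝 0, quartic b g x (u x) = 0 := by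
  have hu0 : u₀ ≠ 0 := by rintro rfl; simp at hu
  set f : ℂ × ℂ → ℂ := fun p => quartic b g p.1 p.2 with hf
  have hc : ContDiffAt ℂ ⊤ f (0, u₀) := by
    unfold f quartic
    fun_prop
  have hd : fderiv ℂ f (0, u₀) ∘L .inr ℂ ℂ ℂ =
      (ContinuousLinearEquiv.unitsEquivAut ℂ (Units.mk0 (4 * u₀ ^ 3) (by simp [hu0])) : ℂ →L[ℂ] ℂ) := by
    have h1 : HasFDerivAt (fun w : ℂ => f (0, w)) (fderiv ℂ f (0, u₀) ∘L .inr ℂ ℂ ℂ) u₀ :=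
      (hc.differentiableAt (by simp)).hasFDerivAt.comp u₀ (hasFDerivAt_prodMk_right 0 u₀)
    have h2 : HasDerivAt (fun w : ℂ => f (0, w)) (4 * u₀ ^ 3) u₀ := by
      simp only [hf, quartic]
      have := (hasDerivAt_pow 4 u₀).sub_const 1
      simpa using this
    ext
    have := h1.hasDerivAt.unique h2
    simpa using this
  have hi : (fderiv ℂ f (0, u₀) ∘L .inr ℂ ℂ ℂ).IsInvertible := hd ▸ ⟨_, rfl⟩
  have h0 : (⊤ : WithTop ℕ∞) ≠ 0 := by simp
  refine ⟨hc.implicitFunction h0 hi, (hc.contDiffAt_implicitFunction h0 hi).analyticAt,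
    hc.implicitFunction_apply_self h0 hi, ?_⟩
  filter_upwards [hc.eventually_apply_implicitFunction h0 hi] with x hx
  have h00 : f (0, u₀) = 0 := by simp [hf, quartic, hu]
  rwa [h00] at hx

/-- Analytic branches, near `x = 0`, of the four roots of `quartic`. -/
structure IsRootBranch (b g : ℂ) (u : Fin 4 → ℂ → ℂ) : Prop where
  analyticAt : ∀ j, AnalyticAt ℂ (u j) 0
  apply_zero : ∀ j, u j 0 = unitRoot j
  quartic_eq_zero : ∀ j, ∀ᶠ x in 𝓝 0, quartic b g x (u j x) = 0

theorem exists_isRootBranch (b g : ℂ) : ∃ u, IsRootBranch b g u := by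
  choose u hu using fun j => exists_analyticAt_quartic_eq_zero b g (unitRoot_pow_four j)
  exact ⟨u, fun j => (hu j).1, fun j => (hu j).2.1, fun j => (hu j).2.2⟩

/-- An approximate root agrees with the exact root to the order of its residual. -/
theorem isBigO_sub_of_quartic_isBigO {b g u₀ : ℂ} {u p : ℂ → ℂ} (hu₀ : u₀ ≠ 0)
    (hu : ContinuousAt u 0) (hp : ContinuousAt p 0) (hu0 : u 0 = u₀) (hp0 : p 0 = u₀)
    (hq : ∀ᶠ x in 𝓝 0, quartic b g x (u x) = 0) {m : ℕ}
    (hO : (fun x => quartic b g x (p x)) =O[𝓝 0] fun x : ℂ => x ^ m) :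
    (fun x => u x - p x) =O[𝓝 0] fun x : ℂ => x ^ m := by
  set Q : ℂ → ℂ := fun x => u x ^ 3 + u x ^ 2 * p x + u x * p x ^ 2 + p x ^ 3
    - g * x ^ 2 * (u x + p x) + 2 * Complex.I * b * x with hQ
  have hQc : ContinuousAt Q 0 := by fun_prop
  have hQ0 : Q 0 ≠ 0 := by
    have : Q 0 = 4 * u₀ ^ 3 := by simp only [hQ, hu0, hp0]; ring
    rw [this]; simp [hu₀]
  have h1 : (fun x => (Q x)⁻¹) =O[𝓝 0] fun _ => (1 : ℂ) := (hQc.inv₀ hQ0).isBigO_one ℂ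
  have h2 := (h1.mul hO).neg_left
  simp only [one_mul] at h2
  refine h2.congr' ?_ EventuallyEq.rfl
  filter_upwards [hq, hQc.eventually_ne hQ0] with x hx hne
  have : quartic b g x (u x) - quartic b g x (p x) = (u x - p x) * Q x := by
    simp only [quartic, hQ]; ring
  rw [hx] at this
  rw [← mul_right_inj' hne, mul_neg, mul_inv_cancel_left₀ hne]
  linear_combination this

theorem isBigO_pow_mul_continuousAt {p : ℂ → ℂ} (hp : ContinuousAt p 0) (m : ℕ) :
    (fun x => x ^ m * p x) =O[𝓝 0] fun x : ℂ => x ^ m := by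
  simpa using (isBigO_refl (fun x : ℂ => x ^ m) (𝓝 0)).mul (hp.isBigO_one ℂ)

theorem IsRootBranch.hasDerivAt {b g : ℂ} {u : Fin 4 → ℂ → ℂ} (hu : IsRootBranch b g u)
    (j : Fin 4) : HasDerivAt (u j) (-Complex.I * b / 2 * unitRoot j ^ 2) 0 := by
  set v := unitRoot j with hv
  have hv4 : v ^ 4 = 1 := unitRoot_pow_four j
  have hv0 : v ≠ 0 := by intro h; simp [h] at hv4
  have h : (fun x => u j x - (v + x * (-Complex.I * b / 2 * v ^ 2))) =O[𝓝 0] fun x : ℂ => x ^ 2 := by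
    refine isBigO_sub_of_quartic_isBigO hv0 (hu.analyticAt j).continuousAt (by fun_prop)
      (hu.apply_zero j) (by simp) (hu.quartic_eq_zero j) ?_
    set a := -Complex.I * b / 2 * v ^ 2 with ha
    refine (isBigO_pow_mul_continuousAt (p := fun x => 6 * v ^ 2 * a ^ 2 + 4 * v * a ^ 3 * x
      + a ^ 4 * x ^ 2 - g * (v + x * a) ^ 2 + 2 * Complex.I * b * a) (by fun_prop) 2).congr_left
      fun x => ?_
    simp only [quartic]
    linear_combination -hv4 + x * 2 * Complex.I * b * v * hv4 - 4 * v ^ 3 * x * ha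
  rw [hasDerivAt_iff_isLittleO]
  simp only [sub_zero, hu.apply_zero, smul_eq_mul]
  refine (h.trans_isLittleO ?_).congr_left fun x => ?_
  · simpa using isLittleO_pow_id (𝕜 := ℂ) (n := 2) one_lt_two
  · ring

/-- The second-order expansion of the frequency `(u₀ - u₁) / (2i)`. -/
theorem IsRootBranch.isBigO_freq {b g : ℂ} {u : Fin 4 → ℂ → ℂ} (hu : IsRootBranch b g u) :
    (fun x => (u 0 x - u 1 x) / (2 * Complex.I) - (1 - (b ^ 2 / 2 + g) / 4 * x ^ 2))
      =O[𝓝 0] fun x : ℂ => x ^ 3 := by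
  have hI := Complex.I_sq
  have key (s : ℂ) (hs : s ^ 2 = 1) (j : Fin 4) (hj : unitRoot j = s * Complex.I) :
      (fun x => u j x - s * Complex.I * (1 + s * b / 2 * x - (b ^ 2 / 2 + g) / 4 * x ^ 2))
        =O[𝓝 0] fun x : ℂ => x ^ 3 := by
    refine isBigO_sub_of_quartic_isBigO (u₀ := unitRoot j) ?_ (hu.analyticAt j).continuousAt
      (by fun_prop) (hu.apply_zero j) (by simp [hj]) (hu.quartic_eq_zero j) ?_
    · intro h; simpa [h] using unitRoot_pow_four j
    · set c := -((b ^ 2 / 2 + g) / 4) with hc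
      refine (isBigO_pow_mul_continuousAt (p := fun x => 4 * (s * b / 2) ^ 3 + 12 * (s * b / 2) * c
        + 2 * g * (s * b / 2) - 2 * s * b * c
        + x * ((s * b / 2) ^ 4 + 12 * (s * b / 2) ^ 2 * c + 6 * c ^ 2
          + g * ((s * b / 2) ^ 2 + 2 * c))
        + x ^ 2 * (4 * (s * b / 2) ^ 3 * c + 12 * (s * b / 2) * c ^ 2 + 2 * g * (s * b / 2) * c)
        + x ^ 3 * (6 * (s * b / 2) ^ 2 * c ^ 2 + 4 * c ^ 3 + g * c ^ 2)
        + x ^ 4 * (4 * (s * b / 2) * c ^ 3) + x ^ 5 * c ^ 4) (by fun_prop) 3).congr_left fun x => ?_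
      have e : 1 + s * b / 2 * x - (b ^ 2 / 2 + g) / 4 * x ^ 2 = 1 + s * b / 2 * x + c * x ^ 2 := by
        rw [hc]; ring
      have e4 : (s * Complex.I) ^ 4 = 1 := by
        rw [mul_pow, Complex.I_pow_four, show s ^ 4 = (s ^ 2) ^ 2 by ring, hs]; ring
      have e2 : (s * Complex.I) ^ 2 = -1 := by rw [mul_pow, hs, hI]; ring
      simp only [quartic]
      rw [e, mul_pow _ _ 4, mul_pow _ _ 2, e4, e2]
      linear_combination (-2 * b * x * s * (1 + s * b / 2 * x + c * x ^ 2)) * hI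
        - (b ^ 2 / 2 * x ^ 2) * hs - 4 * x ^ 2 * hc
  have h0 := key 1 (by ring) 0 (by simp [unitRoot])
  have h1 := key (-1) (by ring) 1 (by simp [unitRoot])
  refine ((h0.sub h1).const_mul_left (1 / (2 * Complex.I))).congr_left fun x => ?_
  field_simp
  ring

/-! ### The characteristic function in terms of exponentials -/

/-- The minor of the two boundary conditions at `1` for the scaled exponents `u, v`. -/
noncomputable def bdryMinor (g k x u v : ℂ) : ℂ :=
  (u ^ 3 - g * x ^ 2 * u) * (x * v ^ 2 + Complex.I * k * v) -
    (v ^ 3 - g * x ^ 2 * v) * (x * u ^ 2 + Complex.I * k * u)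

/-- Laplace expansion along the first two rows. -/
theorem det_bdry (a c d : Fin 4 → ℂ) :
    (Matrix.of ![fun _ => (1 : ℂ), a, c, d]).det =
      (a 1 - a 0) * (c 2 * d 3 - c 3 * d 2) - (a 2 - a 0) * (c 1 * d 3 - c 3 * d 1)
      + (a 3 - a 0) * (c 1 * d 2 - c 2 * d 1) + (a 2 - a 1) * (c 0 * d 3 - c 3 * d 0)
      - (a 3 - a 1) * (c 0 * d 2 - c 2 * d 0) + (a 3 - a 2) * (c 0 * d 1 - c 1 * d 0) := by
  simp [Matrix.det_succ_row_zero, Fin.sum_univ_succ, Fin.succAbove]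
  ring

/-- The characteristic function in the basis of exponentials. The vectors `(1, r, r², r³)` are
eigenvectors of the companion matrix, and the rows `w(0)`, `w″(0)` of the boundary conditions
contribute `1` and `r²`. -/
theorem charDet_mul_det_vandermonde {b g k z : ℂ} {r : Fin 4 → ℂ}
    (hr : ∀ j, r j ^ 4 - g * r j ^ 2 + 2 * z * b * r j + z ^ 2 = 0) :
    -charDet b g k z * (Matrix.vandermonde r).det =
      (Matrix.of ![fun _ => (1 : ℂ), fun j => r j ^ 2,
        fun j => (r j ^ 3 - g * r j) * Complex.exp (r j),
        fun j => (r j ^ 2 + z * k * r j) * Complex.exp (r j)]).det := by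
  set E := NormedSpace.exp (stateMatrix b g z) with hE
  set M : Matrix (Fin 4) (Fin 4) ℂ :=
    Matrix.of ![![1, 0, 0, 0], ![0, 0, 1, 0], shearEntry b g z, feedbackEntry b g k z] with hM
  have hMdet : M.det = -charDet b g k z := by
    simp [hM, Matrix.det_succ_row_zero, Fin.sum_univ_succ, Fin.succAbove, charDet]
    ring
  have hv (j : Fin 4) : E *ᵥ (fun i => r j ^ (i : ℕ)) =
      Complex.exp (r j) • fun i : Fin 4 => r j ^ (i : ℕ) := by
    refine exp_mulVec_eigenvector ?_
    rw [stateMatrix_mulVec]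
    ext i
    fin_cases i
    · simp
    · simp; ring
    · simp; ring
    · simp; linear_combination -hr j
  have hvi (i j : Fin 4) : ∑ l : Fin 4, E i l * r j ^ (l : ℕ) = Complex.exp (r j) * r j ^ (i : ℕ) :=
    congrFun (hv j) i
  rw [← hMdet, ← Matrix.det_transpose (Matrix.vandermonde r), ← Matrix.det_mul]
  congr 1
  ext i j
  rw [Matrix.mul_apply]
  simp only [Matrix.transpose_apply, Matrix.vandermonde_apply]
  have h1 := (Fin.sum_univ_four _).symm.trans (hvi 1 j)
  have h2 := (Fin.sum_univ_four _).symm.trans (hvi 2 j)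
  have h3 := (Fin.sum_univ_four _).symm.trans (hvi 3 j)
  change E 1 0 * r j ^ 0 + E 1 1 * r j ^ 1 + E 1 2 * r j ^ 2 + E 1 3 * r j ^ 3 =
    Complex.exp (r j) * r j ^ 1 at h1
  change E 2 0 * r j ^ 0 + E 2 1 * r j ^ 1 + E 2 2 * r j ^ 2 + E 2 3 * r j ^ 3 =
    Complex.exp (r j) * r j ^ 2 at h2
  change E 3 0 * r j ^ 0 + E 3 1 * r j ^ 1 + E 3 2 * r j ^ 2 + E 3 3 * r j ^ 3 =
    Complex.exp (r j) * r j ^ 3 at h3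
  fin_cases i
  · simp [hM, Fin.sum_univ_four]
  · simp [hM, Fin.sum_univ_four]
  · rw [Fin.sum_univ_four]
    change (E 3 0 - g * E 1 0) * r j ^ 0 + (E 3 1 - g * E 1 1) * r j ^ 1
      + (E 3 2 - g * E 1 2) * r j ^ 2 + (E 3 3 - g * E 1 3) * r j ^ 3
      = (r j ^ 3 - g * r j) * Complex.exp (r j)
    linear_combination h3 - g * h1
  · rw [Fin.sum_univ_four]
    change (E 2 0 + z * k * E 1 0) * r j ^ 0 + (E 2 1 + z * k * E 1 1) * r j ^ 1
      + (E 2 2 + z * k * E 1 2) * r j ^ 2 + (E 2 3 + z * k * E 1 3) * r j ^ 3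
      = (r j ^ 2 + z * k * r j) * Complex.exp (r j)
    linear_combination h2 + z * k * h1

end Tube

/-! ### The normalized characteristic function -/

namespace Tube

open Matrix Bornology

/-- Amplitude of `exp (ρ u₀)` in the normalized characteristic function. -/
noncomputable def ampZero (g k : ℂ) (u : Fin 4 → ℂ → ℂ) (x : ℂ) : ℂ :=
  -(u 3 x ^ 2 - u 1 x ^ 2) * bdryMinor g k x (u 0 x) (u 2 x)

/-- Amplitude of `exp (ρ u₁)` in the normalized characteristic function. -/
noncomputable def ampOne (g k : ℂ) (u : Fin 4 → ℂ → ℂ) (x : ℂ) : ℂ :=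
  (u 3 x ^ 2 - u 0 x ^ 2) * bdryMinor g k x (u 1 x) (u 2 x)

/-- The exponentially small terms of the normalized characteristic function. -/
noncomputable def expRemainder (g k : ℂ) (u : Fin 4 → ℂ → ℂ) (ρ : ℂ) : ℂ :=
  (u 1 ρ⁻¹ ^ 2 - u 0 ρ⁻¹ ^ 2) * bdryMinor g k ρ⁻¹ (u 2 ρ⁻¹) (u 3 ρ⁻¹) * Complex.exp (ρ * u 3 ρ⁻¹)
  - (u 2 ρ⁻¹ ^ 2 - u 0 ρ⁻¹ ^ 2) * bdryMinor g k ρ⁻¹ (u 1 ρ⁻¹) (u 3 ρ⁻¹) *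
    Complex.exp (ρ * u 1 ρ⁻¹ + ρ * u 3 ρ⁻¹ - ρ * u 2 ρ⁻¹)
  + (u 2 ρ⁻¹ ^ 2 - u 1 ρ⁻¹ ^ 2) * bdryMinor g k ρ⁻¹ (u 0 ρ⁻¹) (u 3 ρ⁻¹) *
    Complex.exp (ρ * u 0 ρ⁻¹ + ρ * u 3 ρ⁻¹ - ρ * u 2 ρ⁻¹)
  + (u 3 ρ⁻¹ ^ 2 - u 2 ρ⁻¹ ^ 2) * bdryMinor g k ρ⁻¹ (u 0 ρ⁻¹) (u 1 ρ⁻¹) *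
    Complex.exp (ρ * u 0 ρ⁻¹ + ρ * u 1 ρ⁻¹ - ρ * u 2 ρ⁻¹)

theorem eventually_cobounded_of_nhds {p : ℂ → Prop} (h : ∀ᶠ x in 𝓝 0, p x) :
    ∀ᶠ ρ in cobounded ℂ, p ρ⁻¹ :=
  tendsto_inv₀_cobounded.eventually h

theorem det_vandermonde_smul (ρ : ℂ) (v : Fin 4 → ℂ) :
    (Matrix.vandermonde fun j => ρ * v j).det = ρ ^ 6 * (Matrix.vandermonde v).det := by
  simp only [Matrix.det_vandermonde, Fin.prod_univ_succ, Fin.prod_Ioi_zero, Fin.prod_Ioi_succ]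
  simp
  ring

/-- The characteristic function at `z = i ρ²`, with the factor `exp (ρ u₂)` of the growing exponential
taken out. -/
theorem IsRootBranch.charDet_eq {b g : ℂ} {u : Fin 4 → ℂ → ℂ} (hu : IsRootBranch b g u) (k : ℂ) :
    ∀ᶠ ρ in cobounded ℂ, -charDet b g k (Complex.I * ρ ^ 2) *
        (Matrix.vandermonde fun j => u j ρ⁻¹).det =
      ρ ^ 2 * Complex.exp (ρ * u 2 ρ⁻¹) * (ampZero g k u ρ⁻¹ * Complex.exp (ρ * u 0 ρ⁻¹) +
        ampOne g k u ρ⁻¹ * Complex.exp (ρ * u 1 ρ⁻¹) + expRemainder g k u ρ) := by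
  have hroot : ∀ᶠ ρ in cobounded ℂ, ∀ j, quartic b g ρ⁻¹ (u j ρ⁻¹) = 0 :=
    eventually_all.2 fun j => eventually_cobounded_of_nhds (hu.quartic_eq_zero j)
  filter_upwards [hroot, eventually_ne_cobounded 0] with ρ hq hρ
  have hI := Complex.I_sq
  have hr (j : Fin 4) : (ρ * u j ρ⁻¹) ^ 4 - g * (ρ * u j ρ⁻¹) ^ 2
      + 2 * (Complex.I * ρ ^ 2) * b * (ρ * u j ρ⁻¹) + (Complex.I * ρ ^ 2) ^ 2 = 0 := by
    have := hq j
    simp only [quartic] at this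
    generalize u j ρ⁻¹ = v at this ⊢
    field_simp at this
    linear_combination ρ ^ 2 * this + ρ ^ 4 * hI
  have key := charDet_mul_det_vandermonde (k := k) hr
  rw [det_vandermonde_smul, det_bdry] at key
  have h6 : ρ ^ 6 ≠ 0 := pow_ne_zero _ hρ
  rw [← mul_right_inj' h6]
  have hc (j : Fin 4) : (ρ * u j ρ⁻¹) ^ 3 - g * (ρ * u j ρ⁻¹) =
      ρ ^ 3 * (u j ρ⁻¹ ^ 3 - g * ρ⁻¹ ^ 2 * u j ρ⁻¹) := by field_simp
  have hd (j : Fin 4) : (ρ * u j ρ⁻¹) ^ 2 + Complex.I * ρ ^ 2 * k * (ρ * u j ρ⁻¹) =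
      ρ ^ 3 * (ρ⁻¹ * u j ρ⁻¹ ^ 2 + Complex.I * k * u j ρ⁻¹) := by field_simp
  simp only [hc, hd] at key
  unfold ampZero ampOne expRemainder
  simp only [Complex.exp_add, Complex.exp_sub]
  set e0 := Complex.exp (ρ * u 0 ρ⁻¹)
  set e1 := Complex.exp (ρ * u 1 ρ⁻¹)
  have he2 : Complex.exp (ρ * u 2 ρ⁻¹) ≠ 0 := Complex.exp_ne_zero _
  set e2 := Complex.exp (ρ * u 2 ρ⁻¹)
  set e3 := Complex.exp (ρ * u 3 ρ⁻¹)
  set x := ρ⁻¹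
  have hdiv (s t : ℂ) : e2 * (s * t / e2) = s * t := by field_simp
  have hm (i j : Fin 4) (s t : ℂ) : ρ ^ 3 * (u i x ^ 3 - g * x ^ 2 * u i x) * s *
      (ρ ^ 3 * (x * u j x ^ 2 + Complex.I * k * u j x) * t) -
      ρ ^ 3 * (u j x ^ 3 - g * x ^ 2 * u j x) * t *
      (ρ ^ 3 * (x * u i x ^ 2 + Complex.I * k * u i x) * s) =
      ρ ^ 6 * (s * t) * bdryMinor g k x (u i x) (u j x) := by
    unfold bdryMinor; ring
  simp only [hm] at key
  linear_combination key + ρ ^ 8 * (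
    (u 2 x ^ 2 - u 0 x ^ 2) * bdryMinor g k x (u 1 x) (u 3 x) * hdiv e1 e3
    - (u 2 x ^ 2 - u 1 x ^ 2) * bdryMinor g k x (u 0 x) (u 3 x) * hdiv e0 e3
    - (u 3 x ^ 2 - u 2 x ^ 2) * bdryMinor g k x (u 0 x) (u 1 x) * hdiv e0 e1)

theorem IsRootBranch.det_vandermonde_ne_zero {b g : ℂ} {u : Fin 4 → ℂ → ℂ}
    (hu : IsRootBranch b g u) :
    ∀ᶠ ρ in cobounded ℂ, (Matrix.vandermonde fun j => u j ρ⁻¹).det ≠ 0 := by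
  have h (i j : Fin 4) (hij : i ≠ j) : ∀ᶠ x in 𝓝 (0 : ℂ), u i x - u j x ≠ 0 := by
    refine ((hu.analyticAt i).continuousAt.sub (hu.analyticAt j).continuousAt).eventually_ne ?_
    change u i 0 - u j 0 ≠ 0
    rw [hu.apply_zero, hu.apply_zero, sub_ne_zero]
    revert hij
    fin_cases i <;> fin_cases j <;> simp [unitRoot, Complex.ext_iff] <;> norm_num
  have h' : ∀ᶠ x in 𝓝 (0 : ℂ), ∀ i j : Fin 4, i ≠ j → u i x - u j x ≠ 0 :=
    eventually_all.2 fun i => eventually_all.2 fun j => by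
      by_cases hij : i = j
      · simp [hij]
      · simpa [hij] using h i j hij
  filter_upwards [eventually_cobounded_of_nhds h'] with ρ hρ
  rw [Matrix.det_vandermonde_ne_zero_iff]
  intro i j hij
  by_contra hne
  exact hρ i j hne (sub_eq_zero.2 hij)

/-! ### Sectors and strips -/

/-- Neighbourhoods of infinity in the sector `|Im ρ| ≤ Re ρ`. -/
noncomputable def sectorAtInfinity : Filter ℂ := cobounded ℂ ⊓ 𝓟 {ρ | |ρ.im| ≤ ρ.re}

/-- Neighbourhoods of `+∞` in the strip `|Im ρ| ≤ Y`. -/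
noncomputable def stripAtInfinity (Y : ℝ) : Filter ℂ :=
  cobounded ℂ ⊓ 𝓟 {ρ | |ρ.im| ≤ Y ∧ 0 ≤ ρ.re}

theorem stripAtInfinity_le (Y : ℝ) : stripAtInfinity Y ≤ sectorAtInfinity := by
  refine le_inf inf_le_left (le_principal_iff.2 ?_)
  rw [stripAtInfinity, mem_inf_principal]
  filter_upwards [tendsto_norm_cobounded_atTop.eventually_ge_atTop (2 * Y)] with ρ hρ h
  have := Complex.norm_le_abs_re_add_abs_im ρ
  rw [abs_of_nonneg h.2] at this
  have := h.1
  change |ρ.im| ≤ ρ.re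
  linarith

/-- The characteristic exponents stay within bounded distance of `iρ, -iρ, ρ, -ρ`. -/
theorem exists_norm_root_sub_le {b g : ℂ} {u : Fin 4 → ℂ → ℂ} (hu : IsRootBranch b g u) :
    ∃ B : ℝ, ∀ᶠ ρ in cobounded ℂ, ∀ j, ‖ρ * u j ρ⁻¹ - ρ * unitRoot j‖ ≤ B := by
  have h (j : Fin 4) : ∃ B : ℝ, ∀ᶠ ρ in cobounded ℂ, ‖ρ * u j ρ⁻¹ - ρ * unitRoot j‖ ≤ B := by
    obtain ⟨B, hB⟩ := (hu.hasDerivAt j).isBigO_sub.bound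
    refine ⟨B, ?_⟩
    filter_upwards [eventually_cobounded_of_nhds hB, eventually_ne_cobounded 0] with ρ h1 h2
    rw [hu.apply_zero, sub_zero, norm_inv] at h1
    rw [← mul_sub, norm_mul]
    calc ‖ρ‖ * ‖u j ρ⁻¹ - unitRoot j‖ ≤ ‖ρ‖ * (B * ‖ρ‖⁻¹) := by gcongr
      _ = B := by have := norm_ne_zero_iff.2 h2; field_simp
  choose B hB using h
  refine ⟨∑ j, |B j|, eventually_all.2 fun j => ?_⟩
  filter_upwards [hB j] with ρ hρ
  exact hρ.trans ((le_abs_self _).trans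
    (Finset.single_le_sum (f := fun j => |B j|) (fun i _ => abs_nonneg _) (Finset.mem_univ j)))

theorem exists_norm_inv_le {K : ℂ → ℂ} (hK : ContinuousAt K 0) :
    ∃ M : ℝ, 0 ≤ M ∧ ∀ᶠ ρ in cobounded ℂ, ‖K ρ⁻¹‖ ≤ M :=
  ⟨‖K 0‖ + 1, by positivity, eventually_cobounded_of_nhds
    ((hK.norm.eventually_lt continuousAt_const (by simp)).mono fun _ h => h.le)⟩

theorem IsRootBranch.continuousAt_bdryMinor {b g : ℂ} {u : Fin 4 → ℂ → ℂ}
    (hu : IsRootBranch b g u) (k : ℂ) (i j : Fin 4) :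
    ContinuousAt (fun x => bdryMinor g k x (u i x) (u j x)) 0 := by
  have := fun j => (hu.analyticAt j).continuousAt
  unfold bdryMinor
  have hi := this i
  have hj := this j
  fun_prop

/-- In the sector, the exponents in `expRemainder` have real part at most `-Re ρ + O(1)`. -/
theorem IsRootBranch.exists_norm_expRemainder_le {b g : ℂ} {u : Fin 4 → ℂ → ℂ}
    (hu : IsRootBranch b g u) (k : ℂ) :
    ∃ C : ℝ, 0 ≤ C ∧ ∀ᶠ ρ in sectorAtInfinity, ‖expRemainder g k u ρ‖ ≤ C * Real.exp (-ρ.re) := by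
  obtain ⟨B, hB⟩ := exists_norm_root_sub_le hu
  have hK (l m i j : Fin 4) : ∃ M : ℝ, 0 ≤ M ∧ ∀ᶠ ρ in cobounded ℂ,
      ‖(u l ρ⁻¹ ^ 2 - u m ρ⁻¹ ^ 2) * bdryMinor g k ρ⁻¹ (u i ρ⁻¹) (u j ρ⁻¹)‖ ≤ M := by
    have h1 := (hu.analyticAt l).continuousAt
    have h2 := (hu.analyticAt m).continuousAt
    exact exists_norm_inv_le (((h1.pow 2).sub (h2.pow 2)).mul (hu.continuousAt_bdryMinor k i j))
  obtain ⟨M1, hM1, h1⟩ := hK 1 0 2 3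
  obtain ⟨M2, hM2, h2⟩ := hK 2 0 1 3
  obtain ⟨M3, hM3, h3⟩ := hK 2 1 0 3
  obtain ⟨M4, hM4, h4⟩ := hK 3 2 0 1
  refine ⟨(M1 + M2 + M3 + M4) * Real.exp (3 * B), by positivity, ?_⟩
  rw [sectorAtInfinity, eventually_inf_principal]
  filter_upwards [hB, h1, h2, h3, h4] with ρ hB h1 h2 h3 h4 hs
  have hre (j : Fin 4) : |(ρ * u j ρ⁻¹ - ρ * unitRoot j).re| ≤ B :=
    (Complex.abs_re_le_norm _).trans (hB j)
  have hB0 : 0 ≤ B := (abs_nonneg _).trans (hre 0)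
  have a0 := abs_le.1 (hre 0)
  have a1 := abs_le.1 (hre 1)
  have a2 := abs_le.1 (hre 2)
  have a3 := abs_le.1 (hre 3)
  simp [unitRoot, -Complex.mul_re] at a0 a1 a2 a3
  simp only [Complex.mul_I_re] at a0 a1
  have hy := abs_le.1 (show |ρ.im| ≤ ρ.re from hs)
  have term {K w : ℂ} {M : ℝ} (hK : ‖K‖ ≤ M) (hw : w.re ≤ 3 * B + -ρ.re) :
      ‖K * Complex.exp w‖ ≤ M * (Real.exp (3 * B) * Real.exp (-ρ.re)) := by
    rw [norm_mul, Complex.norm_exp, ← Real.exp_add]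
    have := (norm_nonneg K).trans hK
    gcongr
  unfold expRemainder
  calc _ ≤ M1 * (Real.exp (3 * B) * Real.exp (-ρ.re)) + M2 * (Real.exp (3 * B) * Real.exp (-ρ.re))
        + M3 * (Real.exp (3 * B) * Real.exp (-ρ.re))
        + M4 * (Real.exp (3 * B) * Real.exp (-ρ.re)) := by
        refine (norm_add_le _ _).trans (add_le_add ((norm_add_le _ _).trans (add_le_add
          ((norm_sub_le _ _).trans (add_le_add ?_ ?_)) ?_)) ?_)
        · exact term h1 (by linarith)
        · exact term h2 (by simp only [Complex.add_re, Complex.sub_re]; linarith)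
        · exact term h3 (by simp only [Complex.add_re, Complex.sub_re]; linarith)
        · exact term h4 (by simp only [Complex.add_re, Complex.sub_re]; linarith)
    _ = _ := by ring

theorem ampZero_zero {b g : ℂ} {u : Fin 4 → ℂ → ℂ} (hu : IsRootBranch b g u) (k : ℂ) :
    ampZero g k u 0 = -4 * k := by
  have hI := Complex.I_sq
  simp [ampZero, bdryMinor, hu.apply_zero, unitRoot]
  linear_combination (4 * k) * hI

theorem ampOne_zero {b g : ℂ} {u : Fin 4 → ℂ → ℂ} (hu : IsRootBranch b g u) (k : ℂ) :
    ampOne g k u 0 = -4 * k := by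
  have hI := Complex.I_sq
  simp [ampOne, bdryMinor, hu.apply_zero, unitRoot]
  linear_combination (4 * k - 2 * k * Complex.I ^ 2) * hI

theorem IsRootBranch.analyticAt_ampZero {b g : ℂ} {u : Fin 4 → ℂ → ℂ} (hu : IsRootBranch b g u)
    (k : ℂ) : AnalyticAt ℂ (ampZero g k u) 0 := by
  have h0 := hu.analyticAt 0
  have h1 := hu.analyticAt 1
  have h2 := hu.analyticAt 2
  have h3 := hu.analyticAt 3
  unfold ampZero bdryMinor
  fun_prop

theorem IsRootBranch.analyticAt_ampOne {b g : ℂ} {u : Fin 4 → ℂ → ℂ} (hu : IsRootBranch b g u)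
    (k : ℂ) : AnalyticAt ℂ (ampOne g k u) 0 := by
  have h0 := hu.analyticAt 0
  have h1 := hu.analyticAt 1
  have h2 := hu.analyticAt 2
  have h3 := hu.analyticAt 3
  unfold ampOne bdryMinor
  fun_prop

theorem IsRootBranch.hasDerivAt_ampOne_div_ampZero {b g : ℂ} {u : Fin 4 → ℂ → ℂ}
    (hu : IsRootBranch b g u) {k : ℂ} (hk : k ≠ 0) :
    HasDerivAt (fun x => ampOne g k u x / ampZero g k u x) (-(b + 1 / k)) 0 := by
  have hI := Complex.I_sq
  have h0 := hu.hasDerivAt 0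
  have h1 := hu.hasDerivAt 1
  have h2 := hu.hasDerivAt 2
  have h3 := hu.hasDerivAt 3
  have hm {v w : ℂ → ℂ} {v' w' : ℂ} (hv : HasDerivAt v v' 0) (hw : HasDerivAt w w' 0) :
      HasDerivAt (fun x => bdryMinor g k x (v x) (w x))
        (3 * v 0 ^ 2 * v' * (Complex.I * k * w 0) + v 0 ^ 3 * (w 0 ^ 2 + Complex.I * k * w')
          - (3 * w 0 ^ 2 * w' * (Complex.I * k * v 0)
            + w 0 ^ 3 * (v 0 ^ 2 + Complex.I * k * v'))) 0 := by
    have hc {v : ℂ → ℂ} {v' : ℂ} (hv : HasDerivAt v v' 0) :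
        HasDerivAt (fun x => v x ^ 3 - g * x ^ 2 * v x) (3 * v 0 ^ 2 * v') 0 := by
      refine ((hv.fun_pow 3).fun_sub ((((hasDerivAt_id' (0 : ℂ)).fun_pow 2).const_mul g).fun_mul
        hv)).congr_deriv ?_
      simp
    have hd {v : ℂ → ℂ} {v' : ℂ} (hv : HasDerivAt v v' 0) :
        HasDerivAt (fun x => x * v x ^ 2 + Complex.I * k * v x)
          (v 0 ^ 2 + Complex.I * k * v') 0 := by
      refine (((hasDerivAt_id' (0 : ℂ)).fun_mul (hv.fun_pow 2)).fun_add
        (hv.const_mul (Complex.I * k))).congr_deriv ?_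
      simp
    refine (((hc hv).fun_mul (hd hw)).fun_sub ((hc hw).fun_mul (hd hv))).congr_deriv ?_
    simp
  have hA : HasDerivAt (ampZero g k u)
      (2 * Complex.I * b * k * (1 + Complex.I) - 2 + 2 * Complex.I) 0 := by
    refine (((h3.fun_pow 2).fun_sub (h1.fun_pow 2)).fun_neg.fun_mul (hm h0 h2)).congr_deriv ?_
    simp [hu.apply_zero, unitRoot, bdryMinor]
    linear_combination (2 * b * k * (Complex.I ^ 2 - Complex.I)) * hI
  have hB : HasDerivAt (ampOne g k u)
      (2 * Complex.I * b * k * (1 - Complex.I) + 2 + 2 * Complex.I) 0 := by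
    refine (((h3.fun_pow 2).fun_sub (h0.fun_pow 2)).fun_mul (hm h1 h2)).congr_deriv ?_
    simp [hu.apply_zero, unitRoot, bdryMinor]
    linear_combination (-2 * Complex.I - 2 * b * k * Complex.I
      + b * k * Complex.I ^ 2 * (Complex.I ^ 2 - 2)) * hI
  have hA0 : ampZero g k u 0 ≠ 0 := by simp [ampZero_zero hu, hk]
  refine (hB.fun_div hA hA0).congr_deriv ?_
  rw [ampZero_zero hu, ampOne_zero hu]
  field_simp
  linear_combination (4 * b * k) * hI

end Tube

/-! ### Localization and factorization for large frequencies -/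

namespace Tube

open Matrix Bornology

/-- The zeros of the characteristic function in the sector lie in a strip. -/
theorem IsRootBranch.exists_abs_im_le {b g k : ℂ} {u : Fin 4 → ℂ → ℂ} (hu : IsRootBranch b g u)
    (hk : k ≠ 0) : ∃ Y : ℝ, ∀ᶠ ρ in sectorAtInfinity,
      charDet b g k (Complex.I * ρ ^ 2) = 0 → |ρ.im| ≤ Y := by
  obtain ⟨B, hB⟩ := exists_norm_root_sub_le hu
  obtain ⟨C, hC0, hC⟩ := hu.exists_norm_expRemainder_le k
  have hk' : 0 < ‖k‖ := norm_pos_iff.2 hk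
  have amp {K : ℂ → ℂ} (hK : ContinuousAt K 0) (h0 : K 0 = -4 * k) :
      ∀ᶠ ρ in cobounded ℂ, 3 * ‖k‖ ≤ ‖K ρ⁻¹‖ ∧ ‖K ρ⁻¹‖ ≤ 5 * ‖k‖ := by
    have hn : ‖K 0‖ = 4 * ‖k‖ := by rw [h0, norm_mul]; simp
    have h1 := hK.norm.eventually (lt_mem_nhds (show 3 * ‖k‖ < ‖K 0‖ by linarith))
    have h2 := hK.norm.eventually (gt_mem_nhds (show ‖K 0‖ < 5 * ‖k‖ by linarith))
    filter_upwards [eventually_cobounded_of_nhds h1, eventually_cobounded_of_nhds h2] with ρ h1 h2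
    exact ⟨h1.le, h2.le⟩
  refine ⟨(5 * ‖k‖ * Real.exp B + C) * Real.exp B / (3 * ‖k‖), ?_⟩
  rw [sectorAtInfinity, eventually_inf_principal] at hC ⊢
  filter_upwards [hB, hC, hu.charDet_eq k, amp (hu.analyticAt_ampZero k).continuousAt (ampZero_zero hu k),
    amp (hu.analyticAt_ampOne k).continuousAt (ampOne_zero hu k), eventually_ne_cobounded 0]
    with ρ hB hC hfac hA hA' hρ hs hdet
  have hre (j : Fin 4) : |(ρ * u j ρ⁻¹ - ρ * unitRoot j).re| ≤ B :=
    (Complex.abs_re_le_norm _).trans (hB j)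
  have a0 := abs_le.1 (hre 0)
  have a1 := abs_le.1 (hre 1)
  simp [unitRoot, -Complex.mul_re] at a0 a1
  simp only [Complex.mul_I_re] at a0 a1
  have hx : 0 ≤ ρ.re := (abs_nonneg _).trans hs
  have hT : ‖expRemainder g k u ρ‖ ≤ C := (hC hs).trans
    (mul_le_of_le_one_right hC0 (Real.exp_le_one_iff.2 (by linarith)))
  rw [hdet, neg_zero, zero_mul, eq_comm, mul_eq_zero] at hfac
  have hsum := hfac.resolve_left (mul_ne_zero (pow_ne_zero 2 hρ) (Complex.exp_ne_zero _))
  -- whichever exponential is large is balanced by the bounded other terms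
  have balance {K L w v T : ℂ} (hKL : K * Complex.exp w + L * Complex.exp v + T = 0)
      (hK : 3 * ‖k‖ ≤ ‖K‖) (hL : ‖L‖ ≤ 5 * ‖k‖) (hw : |ρ.im| - B ≤ w.re)
      (hv : v.re ≤ -|ρ.im| + B) (hT : ‖T‖ ≤ C) :
      |ρ.im| ≤ (5 * ‖k‖ * Real.exp B + C) * Real.exp B / (3 * ‖k‖) := by
    have h1 : ‖K * Complex.exp w‖ ≤ 5 * ‖k‖ * Real.exp B + C := by
      have : K * Complex.exp w = -(L * Complex.exp v) - T := by linear_combination hKL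
      rw [this]
      refine (norm_sub_le _ _).trans (add_le_add ?_ hT)
      rw [norm_neg, norm_mul, Complex.norm_exp]
      have : v.re ≤ B := hv.trans (by linarith [abs_nonneg ρ.im])
      gcongr
    have h2 : 3 * ‖k‖ * Real.exp (|ρ.im| - B) ≤ ‖K * Complex.exp w‖ := by
      rw [norm_mul, Complex.norm_exp]
      gcongr
    rw [Real.exp_sub] at h2
    have h3 := h2.trans h1
    rw [le_div_iff₀ (by positivity)]
    rw [mul_div_assoc', div_le_iff₀ (Real.exp_pos B)] at h3
    have h4 := Real.add_one_le_exp |ρ.im|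
    calc |ρ.im| * (3 * ‖k‖) ≤ 3 * ‖k‖ * Real.exp |ρ.im| := by
          rw [mul_comm]
          gcongr
          linarith
      _ ≤ _ := h3
  rcases le_total 0 ρ.im with hy | hy
  · rw [abs_of_nonneg hy] at balance ⊢
    exact balance (K := ampOne g k u ρ⁻¹) (L := ampZero g k u ρ⁻¹) (w := ρ * u 1 ρ⁻¹)
      (v := ρ * u 0 ρ⁻¹) (by linear_combination hsum) hA'.1 hA.2 (by linarith) (by linarith) hT
  · rw [abs_of_nonpos hy] at balance ⊢
    exact balance hsum hA.1 hA'.2 (by linarith) (by linarith) hT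

theorem isBigO_sub_sub_of_analyticAt {f : ℂ → ℂ} {a f' : ℂ} (hf : AnalyticAt ℂ f a)
    (hd : HasDerivAt f f' a) :
    (fun x => f x - f a - f' * (x - a)) =O[𝓝 a] fun x => (x - a) ^ 2 := by
  obtain ⟨p, hp⟩ := hf
  have h := hp.has_fpower_series_dslope_fslope.differentiableAt.isBigO_sub
  refine ((isBigO_refl (fun x : ℂ => x - a) (𝓝 a)).mul h).congr (fun x => ?_) (fun x => by ring)
  rw [mul_sub, ← smul_eq_mul, sub_smul_dslope, dslope_same, hd.deriv]
  ring

/-- The quotient of the two dominant amplitudes, corrected by the exponentially small terms. -/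
noncomputable def ampQuotient (g k : ℂ) (u : Fin 4 → ℂ → ℂ) (ρ : ℂ) : ℂ :=
  (ampOne g k u ρ⁻¹ + expRemainder g k u ρ * Complex.exp (-(ρ * u 1 ρ⁻¹))) / ampZero g k u ρ⁻¹

/-- The function `F` for which the characteristic equation reads `exp (2i (ρ - F ρ)) = -1`. -/
noncomputable def phase (g k : ℂ) (u : Fin 4 → ℂ → ℂ) (ρ : ℂ) : ℂ :=
  ρ - ρ * ((u 0 ρ⁻¹ - u 1 ρ⁻¹) / (2 * Complex.I)) +
    Complex.log (ampQuotient g k u ρ) / (2 * Complex.I)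

/-- The nonvanishing factor of the characteristic function. -/
noncomputable def charFactor (g k : ℂ) (u : Fin 4 → ℂ → ℂ) (ρ : ℂ) : ℂ :=
  -(ρ ^ 2 * Complex.exp (ρ * u 2 ρ⁻¹) * Complex.exp (ρ * u 1 ρ⁻¹) * ampZero g k u ρ⁻¹ *
    ampQuotient g k u ρ) / (Matrix.vandermonde fun j => u j ρ⁻¹).det

theorem isBigO_expRemainder_mul_exp {b g : ℂ} {u : Fin 4 → ℂ → ℂ} (hu : IsRootBranch b g u)
    (k : ℂ) (Y : ℝ) :
    (fun ρ => expRemainder g k u ρ * Complex.exp (-(ρ * u 1 ρ⁻¹))) =O[stripAtInfinity Y]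
      fun ρ => ρ⁻¹ ^ 2 := by
  obtain ⟨B, hB⟩ := exists_norm_root_sub_le hu
  obtain ⟨C, hC0, hC⟩ := hu.exists_norm_expRemainder_le k
  refine IsBigO.of_bound (C * 8 * Real.exp (B + Y)) ?_
  have hC' := hC.filter_mono (stripAtInfinity_le Y)
  have hsec : ∀ᶠ ρ in stripAtInfinity Y, |ρ.im| ≤ ρ.re :=
    (stripAtInfinity_le Y).trans inf_le_right (mem_principal_self _)
  have hstr : ∀ᶠ ρ in stripAtInfinity Y, |ρ.im| ≤ Y ∧ 0 ≤ ρ.re :=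
    inf_le_right (a := cobounded ℂ) (mem_principal_self _)
  filter_upwards [hC', hsec, hstr, inf_le_left (b := 𝓟 _) hB,
    inf_le_left (b := 𝓟 _) (eventually_ne_cobounded (0 : ℂ))] with ρ hC hs hY hB hρ
  have a1 := abs_le.1 ((Complex.abs_re_le_norm _).trans (hB 1))
  simp [unitRoot, -Complex.mul_re] at a1
  simp only [Complex.mul_I_re] at a1
  have hy := abs_le.1 hY.1
  have hn : ‖ρ‖ / 2 ≤ ρ.re := by
    have := Complex.norm_le_abs_re_add_abs_im ρ
    rw [abs_of_nonneg hY.2] at this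
    linarith
  have hρ' : 0 < ‖ρ‖ := norm_pos_iff.2 hρ
  have hexp : Real.exp (-ρ.re) ≤ 8 * ‖ρ⁻¹ ^ 2‖ := by
    rw [norm_pow, norm_inv, Real.exp_neg]
    have h1 : (‖ρ‖ / 2) ^ 2 / 2 ≤ Real.exp ρ.re := by
      have := Real.quadratic_le_exp_of_nonneg (x := ‖ρ‖ / 2) (by positivity)
      have h3 := Real.exp_le_exp.2 hn
      nlinarith
    calc (Real.exp ρ.re)⁻¹ ≤ ((‖ρ‖ / 2) ^ 2 / 2)⁻¹ := inv_anti₀ (by positivity) h1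
      _ = 8 * ‖ρ‖⁻¹ ^ 2 := by field_simp; norm_num
  rw [norm_mul, Complex.norm_exp, Complex.neg_re]
  calc _ ≤ (C * (8 * ‖ρ⁻¹ ^ 2‖)) * Real.exp (B + Y) := by
        gcongr
        · exact hC.trans (by gcongr)
        · linarith
    _ = _ := by ring

theorem isBigO_of_nhds {f e : ℂ → ℂ} (h : f =O[𝓝 0] e) (Y : ℝ) :
    (fun ρ => f ρ⁻¹) =O[stripAtInfinity Y] fun ρ => e ρ⁻¹ :=
  h.comp_tendsto (tendsto_inv₀_cobounded.mono_left inf_le_left)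

theorem tendsto_inv_stripAtInfinity (Y : ℝ) :
    Tendsto (fun ρ : ℂ => ρ⁻¹) (stripAtInfinity Y) (𝓝 0) :=
  tendsto_inv₀_cobounded.mono_left inf_le_left

theorem isBigO_ampQuotient {b g : ℂ} {u : Fin 4 → ℂ → ℂ} (hu : IsRootBranch b g u)
    {k : ℂ} (hk : k ≠ 0) (Y : ℝ) :
    (fun ρ => ampQuotient g k u ρ - 1 - -(b + 1 / k) * ρ⁻¹) =O[stripAtInfinity Y]
      fun ρ => ρ⁻¹ ^ 2 := by
  have hA0 : ampZero g k u 0 ≠ 0 := by simp [ampZero_zero hu, hk]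
  have hA := hu.analyticAt_ampZero k
  have h1 := isBigO_sub_sub_of_analyticAt ((hu.analyticAt_ampOne k).div hA hA0)
    (hu.hasDerivAt_ampOne_div_ampZero hk)
  have h1' := isBigO_of_nhds h1 Y
  have h2 : (fun ρ => (ampZero g k u ρ⁻¹)⁻¹) =O[stripAtInfinity Y] fun _ => (1 : ℂ) :=
    isBigO_of_nhds ((hA.continuousAt.inv₀ hA0).isBigO_one ℂ) Y
  have h3 := h2.mul (isBigO_expRemainder_mul_exp hu k Y)
  simp only [one_mul] at h3
  simp only [sub_zero] at h1'
  refine (h1'.add h3).congr_left fun ρ => ?_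
  have e : ampOne g k u 0 / ampZero g k u 0 = 1 := by
    rw [ampZero_zero hu, ampOne_zero hu, div_self (by simp [hk])]
  simp only [Pi.div_apply, e, ampQuotient]
  rw [div_eq_mul_inv, div_eq_mul_inv]
  ring

theorem isBigO_ampQuotient_sub_one {b g : ℂ} {u : Fin 4 → ℂ → ℂ} (hu : IsRootBranch b g u)
    {k : ℂ} (hk : k ≠ 0) (Y : ℝ) :
    (fun ρ => ampQuotient g k u ρ - 1) =O[stripAtInfinity Y] fun ρ => ρ⁻¹ := by
  have h1 := isBigO_ampQuotient hu hk Y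
  have h2 : (fun ρ : ℂ => ρ⁻¹ ^ 2) =O[stripAtInfinity Y] fun ρ : ℂ => ρ⁻¹ := by
    refine isBigO_of_nhds (f := fun x => x ^ 2) (e := fun x => x) ?_ Y
    simpa using (isLittleO_pow_id (𝕜 := ℂ) (n := 2) one_lt_two).isBigO
  have h3 : (fun ρ : ℂ => -(b + 1 / k) * ρ⁻¹) =O[stripAtInfinity Y] fun ρ : ℂ => ρ⁻¹ :=
    (isBigO_refl _ _).const_mul_left _
  exact ((h1.trans h2).add h3).congr_left fun ρ => by ring

theorem tendsto_ampQuotient {b g : ℂ} {u : Fin 4 → ℂ → ℂ} (hu : IsRootBranch b g u)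
    {k : ℂ} (hk : k ≠ 0) (Y : ℝ) :
    Tendsto (ampQuotient g k u) (stripAtInfinity Y) (𝓝 1) := by
  have := ((isBigO_ampQuotient_sub_one hu hk Y).trans_tendsto
    (tendsto_inv_stripAtInfinity Y)).add_const 1
  simpa using this

/-- The quadratic coefficient of the frequency and the linear coefficient of the amplitude quotient
combine into the first-order term of the phase. -/
theorem isBigO_phase {b g : ℂ} {u : Fin 4 → ℂ → ℂ} (hu : IsRootBranch b g u)
    {k : ℂ} (hk : k ≠ 0) (Y : ℝ) :
    (fun ρ => phase g k u ρ -
      ((b ^ 2 / 2 + g + 2 * Complex.I * b + 2 * Complex.I / k) / 4) * ρ⁻¹)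
      =O[stripAtInfinity Y] fun ρ => ρ⁻¹ ^ 2 := by
  have hI := Complex.I_sq
  have hlog : (fun ρ => Complex.log (ampQuotient g k u ρ) - Complex.log 1
      - 1 * (ampQuotient g k u ρ - 1)) =O[stripAtInfinity Y] fun ρ => ρ⁻¹ ^ 2 := by
    have ha : AnalyticAt ℂ Complex.log 1 := analyticAt_clog (by simp)
    have hd : HasDerivAt Complex.log 1 1 := by
      simpa using Complex.hasDerivAt_log (z := 1) (by simp)
    exact ((isBigO_sub_sub_of_analyticAt ha hd).comp_tendsto (tendsto_ampQuotient hu hk Y)).trans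
      ((isBigO_ampQuotient_sub_one hu hk Y).pow 2)
  have hfreq := (isBigO_refl (fun ρ : ℂ => ρ) (stripAtInfinity Y)).mul
    (isBigO_of_nhds hu.isBigO_freq Y)
  have hne : ∀ᶠ ρ : ℂ in stripAtInfinity Y, ρ ≠ 0 :=
    inf_le_left (b := 𝓟 _) (eventually_ne_cobounded (0 : ℂ))
  have hfreq' : (fun ρ : ℂ => ρ * ((u 0 ρ⁻¹ - u 1 ρ⁻¹) / (2 * Complex.I)
      - (1 - (b ^ 2 / 2 + g) / 4 * ρ⁻¹ ^ 2))) =O[stripAtInfinity Y] fun ρ => ρ⁻¹ ^ 2 := by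
    refine hfreq.congr' EventuallyEq.rfl ?_
    filter_upwards [hne] with ρ hρ
    field_simp
  refine (((hlog.add (isBigO_ampQuotient hu hk Y)).const_mul_left (1 / (2 * Complex.I))).sub
    hfreq').congr' ?_ EventuallyEq.rfl
  filter_upwards [hne] with ρ hρ
  simp only [phase, Complex.log_one]
  have hII : (1 : ℂ) / (2 * Complex.I) = -Complex.I / 2 := by
    field_simp
    linear_combination hI
  rw [div_eq_mul_one_div (Complex.log _), hII, div_eq_mul_one_div (_ - _) (2 * Complex.I), hII]
  field_simp
  ring

theorem charDet_eq_charFactor_mul {b g : ℂ} {u : Fin 4 → ℂ → ℂ} (hu : IsRootBranch b g u)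
    {k : ℂ} (hk : k ≠ 0) (Y : ℝ) :
    ∀ᶠ ρ in stripAtInfinity Y, charFactor g k u ρ ≠ 0 ∧ charDet b g k (Complex.I * ρ ^ 2) =
      charFactor g k u ρ * (Complex.exp (2 * Complex.I * (ρ - phase g k u ρ)) + 1) := by
  have hA0 : ampZero g k u 0 ≠ 0 := by simp [ampZero_zero hu, hk]
  have hA := eventually_cobounded_of_nhds ((hu.analyticAt_ampZero k).continuousAt.eventually_ne hA0)
  filter_upwards [inf_le_left (b := 𝓟 _) hA, inf_le_left (b := 𝓟 _) hu.det_vandermonde_ne_zero,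
    inf_le_left (b := 𝓟 _) (hu.charDet_eq k), (tendsto_ampQuotient hu hk Y).eventually_ne one_ne_zero,
    inf_le_left (b := 𝓟 _) (eventually_ne_cobounded (0 : ℂ))] with ρ hA hV hdet hQ hρ
  refine ⟨?_, ?_⟩
  · exact div_ne_zero (neg_ne_zero.2 (mul_ne_zero (mul_ne_zero (mul_ne_zero (mul_ne_zero
      (pow_ne_zero 2 hρ) (Complex.exp_ne_zero _)) (Complex.exp_ne_zero _)) hA) hQ)) hV
  · have e1 : Complex.exp (2 * Complex.I * (ρ - phase g k u ρ)) =
        Complex.exp (ρ * u 0 ρ⁻¹) / Complex.exp (ρ * u 1 ρ⁻¹) / ampQuotient g k u ρ := by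
      have : 2 * Complex.I * (ρ - phase g k u ρ) =
          ρ * u 0 ρ⁻¹ - ρ * u 1 ρ⁻¹ - Complex.log (ampQuotient g k u ρ) := by
        unfold phase; field_simp; ring
      rw [this, Complex.exp_sub, Complex.exp_sub, Complex.exp_log hQ]
    have e2 : ampZero g k u ρ⁻¹ * Complex.exp (ρ * u 1 ρ⁻¹) * ampQuotient g k u ρ =
        ampOne g k u ρ⁻¹ * Complex.exp (ρ * u 1 ρ⁻¹) + expRemainder g k u ρ := by
      unfold ampQuotient
      rw [Complex.exp_neg]
      have := Complex.exp_ne_zero (ρ * u 1 ρ⁻¹)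
      generalize Complex.exp (ρ * u 1 ρ⁻¹) = e at *
      generalize ampZero g k u ρ⁻¹ = A at *
      field_simp
    rw [e1, charFactor]
    have := Complex.exp_ne_zero (ρ * u 1 ρ⁻¹)
    generalize Complex.exp (ρ * u 1 ρ⁻¹) = e₁ at *
    generalize Complex.exp (ρ * u 0 ρ⁻¹) = e₀ at *
    generalize Complex.exp (ρ * u 2 ρ⁻¹) = e₂ at *
    generalize ampZero g k u ρ⁻¹ = A at *
    generalize (Matrix.vandermonde fun j => u j ρ⁻¹).det = V at *
    field_simp
    linear_combination -hdet + ρ ^ 2 * e₂ * e2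

theorem eventually_differentiableAt_phase {b g : ℂ} {u : Fin 4 → ℂ → ℂ} (hu : IsRootBranch b g u)
    {k : ℂ} (hk : k ≠ 0) (Y : ℝ) :
    ∀ᶠ ρ in stripAtInfinity Y, DifferentiableAt ℂ (phase g k u) ρ ∧
      DifferentiableAt ℂ (charFactor g k u) ρ := by
  have hA0 : ampZero g k u 0 ≠ 0 := by simp [ampZero_zero hu, hk]
  have hA := eventually_cobounded_of_nhds ((hu.analyticAt_ampZero k).continuousAt.eventually_ne hA0)
  have hd : ∀ᶠ ρ in cobounded ℂ, ∀ j, DifferentiableAt ℂ (u j) ρ⁻¹ :=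
    eventually_all.2 fun j => eventually_cobounded_of_nhds
      ((hu.analyticAt j).eventually_analyticAt.mono fun _ h => h.differentiableAt)
  have hslit : ∀ᶠ ρ in stripAtInfinity Y, ampQuotient g k u ρ ∈ Complex.slitPlane :=
    (tendsto_ampQuotient hu hk Y).eventually (Complex.isOpen_slitPlane.mem_nhds (by simp))
  filter_upwards [inf_le_left (b := 𝓟 _) hA, inf_le_left (b := 𝓟 _) hu.det_vandermonde_ne_zero,
    inf_le_left (b := 𝓟 _) hd, hslit,
    inf_le_left (b := 𝓟 _) (eventually_ne_cobounded (0 : ℂ))] with ρ hA hV hd hs hρ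
  have hinv : DifferentiableAt ℂ (fun ρ : ℂ => ρ⁻¹) ρ := differentiableAt_inv hρ
  have hu' (j : Fin 4) : DifferentiableAt ℂ (fun ρ => u j ρ⁻¹) ρ := (hd j).comp ρ hinv
  have hu0 := hu' 0
  have hu1 := hu' 1
  have hu2 := hu' 2
  have hu3 := hu' 3
  have hm (i j : Fin 4) : DifferentiableAt ℂ
      (fun ρ => bdryMinor g k ρ⁻¹ (u i ρ⁻¹) (u j ρ⁻¹)) ρ := by
    have hi := hu' i
    have hj := hu' j
    unfold bdryMinor
    fun_prop
  have m02 := hm 0 2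
  have m12 := hm 1 2
  have m23 := hm 2 3
  have m13 := hm 1 3
  have m03 := hm 0 3
  have m01 := hm 0 1
  have dA : DifferentiableAt ℂ (fun ρ => ampZero g k u ρ⁻¹) ρ := by
    unfold ampZero
    fun_prop
  have dB : DifferentiableAt ℂ (fun ρ => ampOne g k u ρ⁻¹) ρ := by
    unfold ampOne
    fun_prop
  have dT : DifferentiableAt ℂ (fun ρ => expRemainder g k u ρ) ρ := by
    unfold expRemainder
    fun_prop
  have dQ : DifferentiableAt ℂ (ampQuotient g k u) ρ := by
    unfold ampQuotient
    exact (dB.add (dT.mul (by fun_prop))).div dA hA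
  have dlog := dQ.clog hs
  have dV : DifferentiableAt ℂ (fun ρ => (Matrix.vandermonde fun j => u j ρ⁻¹).det) ρ := by
    simp only [Matrix.det_vandermonde]
    fun_prop
  refine ⟨?_, ?_⟩
  · unfold phase
    fun_prop
  · unfold charFactor
    exact (DifferentiableAt.neg (by fun_prop)).div dV hV

end Tube

/-! ### Fixed points and zeros -/

namespace Tube

open Bornology

theorem exists_forall_of_eventually_stripAtInfinity {p : ℂ → Prop} {Y : ℝ}
    (h : ∀ᶠ ρ in stripAtInfinity Y, p ρ) :
    ∃ R : ℝ, 0 < R ∧ ∀ ρ : ℂ, R ≤ ρ.re → |ρ.im| ≤ Y → p ρ := by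
  rw [stripAtInfinity, eventually_inf_principal, ← comap_norm_atTop, eventually_comap] at h
  obtain ⟨R, hR⟩ := eventually_atTop.1 h
  refine ⟨max R 1, by positivity, fun ρ h1 h2 => ?_⟩
  have h3 : 0 ≤ ρ.re := by linarith [le_max_right R 1]
  have h4 : ρ.re ≤ ‖ρ‖ := Complex.re_le_norm ρ
  exact hR ‖ρ‖ (by linarith [le_max_left R 1]) ρ rfl ⟨h2, h3⟩

theorem exists_forall_of_eventually_sectorAtInfinity {p : ℂ → Prop}
    (h : ∀ᶠ ρ in sectorAtInfinity, p ρ) :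
    ∃ R : ℝ, ∀ ρ : ℂ, R ≤ ρ.re → |ρ.im| ≤ ρ.re → p ρ := by
  rw [sectorAtInfinity, eventually_inf_principal, ← comap_norm_atTop, eventually_comap] at h
  obtain ⟨R, hR⟩ := eventually_atTop.1 h
  exact ⟨R, fun ρ h1 h2 => hR ‖ρ‖ (h1.trans (Complex.re_le_norm ρ)) ρ rfl h2⟩

/-- A function bounded by `1/4` on `Re ρ ≥ R`, `|Im ρ| ≤ Y` has a derivative bounded by `1/4` at
distance one from the boundary. -/
theorem norm_deriv_le_of_strip {F : ℂ → ℂ} {R Y : ℝ}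
    (hF : ∀ ρ : ℂ, R ≤ ρ.re → |ρ.im| ≤ Y → DifferentiableAt ℂ F ρ ∧ ‖F ρ‖ ≤ 1 / 4) {ρ : ℂ}
    (h1 : R + 1 ≤ ρ.re) (h2 : |ρ.im| ≤ Y - 1) : ‖deriv F ρ‖ ≤ 1 / 4 := by
  have hsub : ∀ w ∈ Metric.closedBall ρ 1, DifferentiableAt ℂ F w ∧ ‖F w‖ ≤ 1 / 4 := by
    intro w hw
    rw [Metric.mem_closedBall, dist_eq_norm] at hw
    have hre := (Complex.abs_re_le_norm (w - ρ)).trans hw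
    have him := (Complex.abs_im_le_norm (w - ρ)).trans hw
    rw [Complex.sub_re] at hre
    rw [Complex.sub_im] at him
    refine hF w (by linarith [(abs_le.1 hre).1]) ?_
    have := abs_sub_abs_le_abs_sub w.im ρ.im
    linarith
  have h := Complex.norm_deriv_le_of_forall_mem_sphere_norm_le (f := F) (c := ρ) one_pos
    (C := 1 / 4) ?_ fun w hw => (hsub w (Metric.sphere_subset_closedBall hw)).2
  · simpa using h
  · refine DifferentiableOn.diffContOnCl fun w hw => ?_
    exact (hsub w (Metric.closure_ball_subset_closedBall hw)).1.differentiableWithinAt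

theorem norm_sub_le_of_ball {F : ℂ → ℂ} {R Y : ℝ}
    (hF : ∀ ρ : ℂ, R ≤ ρ.re → |ρ.im| ≤ Y → DifferentiableAt ℂ F ρ ∧ ‖F ρ‖ ≤ 1 / 4) (hY : 2 ≤ Y)
    {x : ℝ} (hx : R + 2 ≤ x) {ρ w : ℂ} (hρ : ρ ∈ Metric.closedBall (x : ℂ) 1)
    (hw : w ∈ Metric.closedBall (x : ℂ) 1) : ‖F w - F ρ‖ ≤ 1 / 4 * ‖w - ρ‖ := by
  have hreg : ∀ v ∈ Metric.closedBall (x : ℂ) 1, R + 1 ≤ v.re ∧ |v.im| ≤ 1 := by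
    intro v hv
    rw [Metric.mem_closedBall, dist_eq_norm] at hv
    have hre := (Complex.abs_re_le_norm (v - x)).trans hv
    have him := (Complex.abs_im_le_norm (v - x)).trans hv
    rw [Complex.sub_re, Complex.ofReal_re] at hre
    rw [Complex.sub_im, Complex.ofReal_im, sub_zero] at him
    exact ⟨by linarith [(abs_le.1 hre).1], him⟩
  refine (convex_closedBall (x : ℂ) 1).norm_image_sub_le_of_norm_deriv_le (fun v hv => ?_)
    (fun v hv => ?_) hρ hw
  · obtain ⟨h1, h2⟩ := hreg v hv
    exact (hF v (by linarith) (by linarith)).1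
  · obtain ⟨h1, h2⟩ := hreg v hv
    exact norm_deriv_le_of_strip hF h1 (by linarith)

theorem exists_fixedPoint {F : ℂ → ℂ} {R Y : ℝ}
    (hF : ∀ ρ : ℂ, R ≤ ρ.re → |ρ.im| ≤ Y → DifferentiableAt ℂ F ρ ∧ ‖F ρ‖ ≤ 1 / 4) (hY : 2 ≤ Y)
    {x : ℝ} (hx : R + 2 ≤ x) : ∃ ρ ∈ Metric.closedBall (x : ℂ) 1, ρ = x + F ρ := by
  set S := Metric.closedBall (x : ℂ) 1
  have hmaps : MapsTo (fun ρ => x + F ρ) S S := by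
    intro v hv
    rw [Metric.mem_closedBall, dist_eq_norm] at hv ⊢
    have hre := (Complex.abs_re_le_norm (v - x)).trans hv
    have him := (Complex.abs_im_le_norm (v - x)).trans hv
    rw [Complex.sub_re, Complex.ofReal_re] at hre
    rw [Complex.sub_im, Complex.ofReal_im, sub_zero] at him
    have := (hF v (by linarith [(abs_le.1 hre).1]) (by linarith)).2
    simp only [add_sub_cancel_left]
    linarith
  have hc : ContractingWith (1 / 4) (hmaps.restrict (fun ρ => x + F ρ) S S) := by
    refine ⟨by
      rw [← NNReal.coe_lt_coe]; norm_num, LipschitzWith.of_dist_le_mul fun v w => ?_⟩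
    rw [Subtype.dist_eq, Subtype.dist_eq, dist_eq_norm, dist_eq_norm]
    simpa using norm_sub_le_of_ball hF hY hx w.2 v.2
  obtain ⟨y, hy, hfix, -⟩ := hc.exists_fixedPoint' Metric.isClosed_closedBall.isComplete hmaps
    (Metric.mem_closedBall_self zero_le_one) (edist_ne_top _ _)
  exact ⟨y, hy, hfix.symm⟩

theorem exp_two_I_mul_eq_neg_one_iff {w : ℂ} :
    Complex.exp (2 * Complex.I * w) = -1 ↔ ∃ m : ℤ, w = (m + 1 / 2) * Real.pi := by
  rw [← Complex.exp_pi_mul_I, Complex.exp_eq_exp_iff_exists_int]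
  refine exists_congr fun m => ?_
  have h2 : (2 * Complex.I) ≠ 0 := by simp
  rw [← mul_right_inj' (c := (m + 1 / 2) * (Real.pi : ℂ)) h2]
  constructor <;> intro h <;> rw [h] <;> ring

theorem finite_zeros_of_differentiable {f : ℂ → ℂ} (hf : Differentiable ℂ f) {a : ℂ} (ha : f a ≠ 0)
    (R : ℝ) : {z : ℂ | f z = 0 ∧ ‖z‖ ≤ R}.Finite := by
  by_contra hinf
  obtain ⟨x, -, hx⟩ := Set.Infinite.exists_accPt_of_subset_isCompact hinf
    (isCompact_closedBall (0 : ℂ) R) fun z hz => by simpa using hz.2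
  have hfr : ∃ᶠ z in 𝓝[≠] x, f z = 0 :=
    (accPt_iff_frequently_nhdsNE.1 hx).mono fun z hz => hz.1
  have han : AnalyticOnNhd ℂ f univ := fun z _ => hf.analyticAt z
  exact ha (han.eqOn_zero_of_preconnected_of_frequently_eq_zero isPreconnected_univ (mem_univ x) hfr
    (mem_univ a))

/-- Every number with nonnegative imaginary part is `i ρ²` with `ρ` in the sector
`|Im ρ| ≤ Re ρ`. -/
theorem exists_eq_I_mul_sq {z : ℂ} (hz : 0 ≤ z.im) :
    ∃ ρ : ℂ, z = Complex.I * ρ ^ 2 ∧ |ρ.im| ≤ ρ.re := by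
  obtain ⟨w, hw⟩ := IsAlgClosed.exists_pow_nat_eq (-Complex.I * z) (n := 2) two_pos
  have hw' : z = Complex.I * w ^ 2 := by
    rw [hw]; linear_combination z * Complex.I_sq
  have hre : w.im ^ 2 ≤ w.re ^ 2 := by
    have h := congrArg Complex.im hw'
    simp [sq] at h
    nlinarith
  have habs : |w.im| ≤ |w.re| := sq_le_sq.1 hre
  rcases le_total 0 w.re with h | h
  · exact ⟨w, hw', by rwa [abs_of_nonneg h] at habs⟩
  · refine ⟨-w, by rw [hw', neg_sq], ?_⟩
    rw [abs_of_nonpos h] at habs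
    simpa using habs

/-- A simple zero of the characteristic function in the variable `ρ` is a simple zero in the
variable `z = i ρ²`. -/
theorem charDet_simple_zero_of_factorization {β η γ κ : ℝ} {H E : ℂ → ℂ} {w d : ℂ}
    (heq : ∀ᶠ v in 𝓝 w, charDet (β * η) (γ - η ^ 2) κ (Complex.I * v ^ 2) = H v * E v)
    (hH : H w ≠ 0) (hHd : DifferentiableAt ℂ H w) (hE : E w = 0) (hEd : HasDerivAt E d w)
    (hd : d ≠ 0) :
    charDet (β * η) (γ - η ^ 2) κ (Complex.I * w ^ 2) = 0 ∧
      deriv (charDet (β * η) (γ - η ^ 2) κ) (Complex.I * w ^ 2) ≠ 0 := by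
  have h0 : charDet (β * η) (γ - η ^ 2) κ (Complex.I * w ^ 2) = 0 := by
    rw [heq.self_of_nhds, hE, mul_zero]
  refine ⟨h0, fun hz => ?_⟩
  have h1 : HasDerivAt (fun v => H v * E v) (H w * d) w :=
    (hHd.hasDerivAt.fun_mul hEd).congr_deriv (by rw [hE]; ring)
  have h2 := h1.congr_of_eventuallyEq heq
  have h3 : HasDerivAt (charDet (β * η) (γ - η ^ 2) κ) 0 (Complex.I * w ^ 2) := by
    rw [← hz]; exact (differentiable_charDet _ _ _ _).hasDerivAt
  have h4 := h3.comp w (((hasDerivAt_id w).fun_pow 2).const_mul Complex.I)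
  rw [zero_mul] at h4
  exact mul_ne_zero hH hd (h2.unique h4)

end Tube

/-! ### Asymptotics of the eigenvalues -/

namespace Tube

open Bornology

theorem le_freq (n : ℕ) : (n : ℝ) + 1 ≤ freq n := by
  unfold freq
  have := Real.pi_gt_three
  have hn : (0 : ℝ) ≤ n := n.cast_nonneg
  nlinarith

theorem freq_pos (n : ℕ) : 0 < freq n := by
  have := le_freq n
  have hn : (0 : ℝ) ≤ n := n.cast_nonneg
  linarith

theorem tendsto_freq : Tendsto freq atTop atTop :=
  tendsto_atTop_mono (fun n => (by linarith [le_freq n] : (n : ℝ) ≤ freq n))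
    tendsto_natCast_atTop_atTop

theorem isBigO_inv_freq : (fun n => (freq n : ℂ)⁻¹) =O[atTop] fun n : ℕ => 1 / (n : ℝ) := by
  refine IsBigO.of_bound 1 ?_
  filter_upwards [eventually_gt_atTop 0] with n hn
  have hn' : (0 : ℝ) < n := by exact_mod_cast hn
  rw [norm_inv, Complex.norm_real, Real.norm_of_nonneg (freq_pos n).le, one_mul,
    Real.norm_of_nonneg (by positivity), one_div]
  exact inv_anti₀ hn' (by linarith [le_freq n])

theorem isBigO_freq_mul {e : ℕ → ℂ} (he : e =O[atTop] fun n : ℕ => 1 / (n : ℝ) ^ 2) :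
    (fun n => e n * (freq n : ℂ)) =O[atTop] fun n : ℕ => 1 / (n : ℝ) := by
  have hf : (fun n => (freq n : ℂ)) =O[atTop] fun n : ℕ => (n : ℝ) := by
    refine IsBigO.of_bound (2 * Real.pi) ?_
    filter_upwards [eventually_gt_atTop 0] with n hn
    have hn' : (1 : ℝ) ≤ n := by exact_mod_cast hn
    rw [Complex.norm_real, Real.norm_of_nonneg (freq_pos n).le, Real.norm_of_nonneg (by positivity)]
    unfold freq
    have := Real.pi_pos
    nlinarith
  refine (he.mul hf).congr' EventuallyEq.rfl ?_
  filter_upwards [eventually_gt_atTop 0] with n hn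
  have hn' : (n : ℝ) ≠ 0 := by exact_mod_cast hn.ne'
  field_simp

/-- One step of the fixed point iteration gives the asymptotics of the fixed points. -/
theorem isBigO_fixedPoint {F : ℂ → ℂ} {q : ℂ} {Y : ℝ} {ρ : ℕ → ℂ}
    (hF : (fun v => F v - q * v⁻¹) =O[stripAtInfinity Y] fun v => v⁻¹ ^ 2)
    (hρ : ∀ᶠ n in atTop, ρ n = freq n + F (ρ n) ∧ ‖F (ρ n)‖ ≤ 1 / 4)
    (ht : Tendsto ρ atTop (stripAtInfinity Y)) :
    (fun n => ρ n - (freq n + q / freq n)) =O[atTop] fun n : ℕ => 1 / (n : ℝ) ^ 2 := by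
  have hinv : (fun n => (ρ n)⁻¹) =O[atTop] fun n : ℕ => 1 / (n : ℝ) := by
    refine IsBigO.of_bound 1 ?_
    filter_upwards [eventually_gt_atTop 0, hρ] with n hn h
    have hn' : (0 : ℝ) < n := by exact_mod_cast hn
    rw [norm_inv, one_mul, Real.norm_of_nonneg (by positivity), one_div]
    refine inv_anti₀ hn' ?_
    have h1 : (freq n : ℂ) = ρ n - F (ρ n) := by linear_combination -h.1
    have h2 : freq n ≤ ‖ρ n‖ + ‖F (ρ n)‖ := by
      rw [← Real.norm_of_nonneg (freq_pos n).le, ← Complex.norm_real, h1]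
      exact norm_sub_le _ _
    linarith [le_freq n, h.2]
  have hsq : ∀ n : ℕ, 1 / (n : ℝ) * (1 / (n : ℝ)) = 1 / (n : ℝ) ^ 2 := fun n => by
    rw [div_mul_div_comm, one_mul, sq]
  have h1 : (fun n => F (ρ n) - q * (ρ n)⁻¹) =O[atTop] fun n : ℕ => 1 / (n : ℝ) ^ 2 := by
    refine (hF.comp_tendsto ht).trans ?_
    exact (hinv.mul hinv).congr (fun n => (sq _).symm) hsq
  have hb : (fun n => F (ρ n)) =O[atTop] fun _ : ℕ => (1 : ℝ) :=
    IsBigO.of_bound (1 / 4) (hρ.mono fun n h => by simpa using h.2)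
  have h2 : (fun n => q * (F (ρ n) * ((ρ n)⁻¹ * (freq n : ℂ)⁻¹))) =O[atTop]
      fun n : ℕ => 1 / (n : ℝ) ^ 2 :=
    ((hb.mul (hinv.mul isBigO_inv_freq)).congr_right fun n => by
      rw [one_mul, hsq]).const_mul_left q
  refine (h1.sub h2).congr' ?_ EventuallyEq.rfl
  have hne : ∀ᶠ n in atTop, ρ n ≠ 0 := ht.eventually
    (inf_le_left (b := 𝓟 _) (eventually_ne_cobounded (0 : ℂ)))
  filter_upwards [hρ, hne] with n h hn
  have hf : (freq n : ℂ) ≠ 0 := by exact_mod_cast (freq_pos n).ne'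
  have hFn : F (ρ n) = ρ n - freq n := by linear_combination -h.1
  rw [hFn]
  field_simp
  ring

theorem isBigO_I_mul_sq {q : ℂ} {ρ : ℕ → ℂ}
    (h : (fun n => ρ n - (freq n + q / freq n)) =O[atTop] fun n : ℕ => 1 / (n : ℝ) ^ 2) :
    (fun n => Complex.I * ρ n ^ 2 - (Complex.I * freq n ^ 2 + 2 * Complex.I * q)) =O[atTop]
      fun n : ℕ => 1 / (n : ℝ) := by
  set e : ℕ → ℂ := fun n => ρ n - (freq n + q / freq n) with he
  have hone : (fun n : ℕ => 1 / (n : ℝ)) =O[atTop] fun _ : ℕ => (1 : ℝ) :=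
    tendsto_one_div_atTop_nhds_zero_nat.isBigO_one ℝ
  have hsq : (fun n : ℕ => 1 / (n : ℝ) ^ 2) =O[atTop] fun n : ℕ => 1 / (n : ℝ) := by
    refine ((isBigO_refl (fun n : ℕ => 1 / (n : ℝ)) atTop).mul hone).congr (fun n => ?_)
      fun n => by rw [mul_one]
    rw [div_mul_div_comm, one_mul, sq]
  have h1 := isBigO_freq_mul h
  have hinv := isBigO_inv_freq
  have h2 : (fun n => (freq n : ℂ)⁻¹ * (freq n : ℂ)⁻¹) =O[atTop] fun n : ℕ => 1 / (n : ℝ) :=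
    (hinv.mul (hinv.trans hone)).congr_right fun n => mul_one _
  have h3 : (fun n => e n * (freq n : ℂ)⁻¹) =O[atTop] fun n : ℕ => 1 / (n : ℝ) :=
    ((h.trans hsq).mul (hinv.trans hone)).congr_right fun n => mul_one _
  have h4 : (fun n => e n * e n) =O[atTop] fun n : ℕ => 1 / (n : ℝ) :=
    ((h.trans hsq).mul ((h.trans hsq).trans hone)).congr_right fun n => mul_one _
  refine (((((h2.const_mul_left (q ^ 2)).add (h1.const_mul_left 2)).add
    (h3.const_mul_left (2 * q))).add h4).const_mul_left Complex.I).congr_left fun n => ?_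
  have hf : (freq n : ℂ) ≠ 0 := by exact_mod_cast (freq_pos n).ne'
  simp only [he]
  field_simp
  ring

end Tube

open Tube in
theorem theorem3p2 (β η γ κ : ℝ) (hβ : β ∈ Ioo (0 : ℝ) 1) (hη : 0 ≤ η) (hγ : η ^ 2 < γ)
    (hκ : 0 < κ) :
    ∃ (N : ℕ) (ρ l : ℕ → ℂ),
      -- the numbers `l n = i (ρ n)²`
      (∀ n, l n = Complex.I * ρ n ^ 2) ∧
      -- are, with their conjugates, simple eigenvalues, pairwise distinct, in the open
      -- left half-plane
      (∀ n ≥ N, Tube.IsSimpleEigenvalue β η γ κ (l n) ∧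
        Tube.IsSimpleEigenvalue β η γ κ (starRingEnd ℂ (l n)) ∧
        (l n).re < 0 ∧ 0 < (l n).im) ∧
      InjOn l (Ici N) ∧
      -- and there are only finitely many other eigenvalues
      {z : ℂ | Tube.IsEigenvalue β η γ κ z ∧
        ∀ n ≥ N, z ≠ l n ∧ z ≠ starRingEnd ℂ (l n)}.Finite ∧
      -- asymptotics of `ρ n`
      (fun n : ℕ => ρ n - ((Tube.freq n : ℂ) +
          ((β : ℂ) ^ 2 * (η : ℂ) ^ 2 / 2 + (γ : ℂ) - (η : ℂ) ^ 2
            + 2 * Complex.I * (β : ℂ) * (η : ℂ) + 2 * Complex.I / (κ : ℂ))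
          / (4 * (Tube.freq n : ℂ))))
        =O[atTop] (fun n : ℕ => 1 / (n : ℝ) ^ 2) ∧
      -- asymptotics of the eigenvalues
      (fun n : ℕ => l n - (-((β : ℂ) * (η : ℂ) + 1 / (κ : ℂ)) +
          Complex.I * ((Tube.freq n : ℂ) ^ 2
            + ((β : ℂ) ^ 2 * (η : ℂ) ^ 2 / 2 + (γ : ℂ) - (η : ℂ) ^ 2) / 2)))
        =O[atTop] (fun n : ℕ => 1 / (n : ℝ)) ∧
      -- vertical asymptote in the open left half-plane
      -(β * η + 1 / κ) < 0 ∧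
      Tendsto (fun n : ℕ => (l n).re) atTop (𝓝 (-(β * η + 1 / κ))) ∧
      Tendsto (fun n : ℕ => (l n).im) atTop atTop := by
  set b : ℂ := β * η with hb
  set g : ℂ := γ - η ^ 2 with hg
  have hk : (κ : ℂ) ≠ 0 := by exact_mod_cast hκ.ne'
  obtain ⟨u, hu⟩ := exists_isRootBranch b g
  obtain ⟨Y₀, hY₀⟩ := hu.exists_abs_im_le hk
  obtain ⟨R₀, hR₀⟩ := exists_forall_of_eventually_sectorAtInfinity hY₀
  set Y : ℝ := max Y₀ 0 + 2 with hY
  have hY2 : 2 ≤ Y := by linarith [le_max_right Y₀ 0]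
  set F := phase g κ u with hFdef
  set H := charFactor g κ u with hHdef
  set q : ℂ := (b ^ 2 / 2 + g + 2 * Complex.I * b + 2 * Complex.I / κ) / 4 with hq
  have hFO := isBigO_phase hu hk Y
  have hFsmall : ∀ᶠ v in stripAtInfinity Y, ‖F v‖ ≤ 1 / 4 := by
    have h0 := tendsto_inv_stripAtInfinity Y
    have h1 : Tendsto F (stripAtInfinity Y) (𝓝 0) := by
      have := (hFO.trans_tendsto (by simpa using h0.pow 2)).add (h0.const_mul q)
      rw [mul_zero, add_zero] at this
      exact this.congr fun v => sub_add_cancel _ _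
    have := h1.norm.eventually (gt_mem_nhds (show ‖(0 : ℂ)‖ < 1 / 4 by simp))
    exact this.mono fun _ h => h.le
  obtain ⟨R, hR0, hR⟩ := exists_forall_of_eventually_stripAtInfinity
    ((charDet_eq_charFactor_mul hu hk Y).and ((eventually_differentiableAt_phase hu hk Y).and hFsmall))
  have hFR : ∀ v : ℂ, R ≤ v.re → |v.im| ≤ Y → DifferentiableAt ℂ F v ∧ ‖F v‖ ≤ 1 / 4 :=
    fun v h1 h2 => ⟨(hR v h1 h2).2.1.1, (hR v h1 h2).2.2⟩
  -- from `N₀` on, the fixed point equation has a unique solution near `freq n`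
  obtain ⟨N₀, hN₀⟩ := eventually_atTop.1 (tendsto_freq.eventually_ge_atTop (R + 3))
  have hex : ∀ n, ∃ v : ℂ, N₀ ≤ n → v ∈ Metric.closedBall (freq n : ℂ) 1 ∧ v = freq n + F v := by
    intro n
    by_cases hn : N₀ ≤ n
    · obtain ⟨v, hv⟩ := exists_fixedPoint hFR hY2 (x := freq n) (by linarith [hN₀ n hn])
      exact ⟨v, fun _ => hv⟩
    · exact ⟨0, fun h => absurd h hn⟩
  choose ρ hρ using hex
  have hreg : ∀ n, N₀ ≤ n → freq n - 1 ≤ (ρ n).re ∧ |(ρ n).im| ≤ 1 ∧ ‖F (ρ n)‖ ≤ 1 / 4 := by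
    intro n hn
    have hv := (hρ n hn).1
    rw [Metric.mem_closedBall, dist_eq_norm] at hv
    have hre := (Complex.abs_re_le_norm (ρ n - freq n)).trans hv
    have him := (Complex.abs_im_le_norm (ρ n - freq n)).trans hv
    rw [Complex.sub_re, Complex.ofReal_re] at hre
    rw [Complex.sub_im, Complex.ofReal_im, sub_zero] at him
    have h1 : freq n - 1 ≤ (ρ n).re := by linarith [(abs_le.1 hre).1]
    exact ⟨h1, him, (hFR _ (by linarith [hN₀ n hn]) (by linarith)).2⟩
  have htend : Tendsto ρ atTop (stripAtInfinity Y) := by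
    refine tendsto_inf.2 ⟨?_, tendsto_principal.2 ?_⟩
    · rw [← tendsto_norm_atTop_iff_cobounded]
      refine tendsto_atTop_mono' _ ?_ (tendsto_atTop_add_const_right _ (-1) tendsto_freq)
      filter_upwards [eventually_ge_atTop N₀] with n hn
      linarith [(hreg n hn).1, Complex.re_le_norm (ρ n)]
    · filter_upwards [eventually_ge_atTop N₀] with n hn
      exact ⟨by linarith [(hreg n hn).2.1], by linarith [(hreg n hn).1, hN₀ n hn]⟩
  have hzero : ∀ n, N₀ ≤ n → charDet b g κ (Complex.I * ρ n ^ 2) = 0 ∧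
      deriv (charDet b g κ) (Complex.I * ρ n ^ 2) ≠ 0 := by
    intro n hn
    obtain ⟨h1, h2, -⟩ := hreg n hn
    have hre : R + 2 ≤ (ρ n).re := by linarith [hN₀ n hn]
    have hnear : ∀ᶠ v in 𝓝 (ρ n), charDet b g κ (Complex.I * v ^ 2) =
        H v * (Complex.exp (2 * Complex.I * (v - F v)) + 1) := by
      have e1 : ∀ᶠ v : ℂ in 𝓝 (ρ n), R < v.re :=
        Complex.continuous_re.continuousAt.eventually (lt_mem_nhds (by linarith))
      have e2 : ∀ᶠ v : ℂ in 𝓝 (ρ n), |v.im| < Y :=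
        (Complex.continuous_im.abs).continuousAt.eventually (gt_mem_nhds (by linarith))
      filter_upwards [e1, e2] with v h1 h2
      exact (hR v h1.le h2.le).1.2
    have hreg' := hR (ρ n) (by linarith) (by linarith)
    have hexp : Complex.exp (2 * Complex.I * (ρ n - F (ρ n))) = -1 := by
      rw [exp_two_I_mul_eq_neg_one_iff]
      refine ⟨n, ?_⟩
      have : ρ n - F (ρ n) = freq n := by linear_combination (hρ n hn).2
      rw [this]
      simp [freq]
    have hE : HasDerivAt (fun v => Complex.exp (2 * Complex.I * (v - F v)) + 1)
        (-1 * (2 * Complex.I * (1 - deriv F (ρ n)))) (ρ n) := by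
      have h := ((((hasDerivAt_id' (ρ n)).fun_sub hreg'.2.1.1.hasDerivAt).const_mul
        (2 * Complex.I)).cexp).add_const 1
      rwa [hexp] at h
    refine charDet_simple_zero_of_factorization hnear hreg'.1.1 hreg'.2.1.2 (by simp [hexp]) hE ?_
    have hd := norm_deriv_le_of_strip hFR (ρ := ρ n) (by linarith) (by linarith)
    have hne : 1 - deriv F (ρ n) ≠ 0 := by
      intro h
      rw [← sub_eq_zero.1 h] at hd
      norm_num at hd
    simp [hne]
  have hasy := isBigO_fixedPoint hFO ((eventually_ge_atTop N₀).mono fun n hn =>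
    ⟨(hρ n hn).2, (hreg n hn).2.2⟩) htend
  have hasyl := isBigO_I_mul_sq hasy
  have hII := Complex.I_sq
  set l : ℕ → ℂ := fun n => Complex.I * ρ n ^ 2 with hl
  have hasyl' : (fun n : ℕ => l n - (-((β : ℂ) * (η : ℂ) + 1 / (κ : ℂ)) +
      Complex.I * ((Tube.freq n : ℂ) ^ 2
        + ((β : ℂ) ^ 2 * (η : ℂ) ^ 2 / 2 + (γ : ℂ) - (η : ℂ) ^ 2) / 2)))
        =O[atTop] (fun n : ℕ => 1 / (n : ℝ)) := by
    refine hasyl.congr_left fun n => ?_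
    simp only [hb, hg, hl]
    linear_combination (-(β * η : ℂ) - 1 / κ) * hII
  have hlim := hasyl'.trans_tendsto tendsto_one_div_atTop_nhds_zero_nat
  have hre : Tendsto (fun n : ℕ => (l n).re) atTop (𝓝 (-(β * η + 1 / κ))) := by
    have h1 := (Complex.continuous_re.tendsto 0).comp hlim
    have h2 := h1.add_const (-(β * η + 1 / κ))
    rw [Complex.zero_re, zero_add] at h2
    refine h2.congr fun n => ?_
    have e : (-((β : ℂ) * (η : ℂ) + 1 / (κ : ℂ)) + Complex.I * ((Tube.freq n : ℂ) ^ 2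
        + ((β : ℂ) ^ 2 * (η : ℂ) ^ 2 / 2 + (γ : ℂ) - (η : ℂ) ^ 2) / 2)) =
        ((-(β * η + 1 / κ) : ℝ) : ℂ) +
          ((freq n ^ 2 + (β ^ 2 * η ^ 2 / 2 + γ - η ^ 2) / 2 : ℝ) : ℂ) * Complex.I := by
      push_cast; ring
    rw [Function.comp_apply, e, Complex.sub_re, Complex.add_re, Complex.ofReal_re,
      Complex.re_ofReal_mul, Complex.I_re]
    ring
  have him : Tendsto (fun n : ℕ => (l n).im) atTop atTop := by
    have h1 := (Complex.continuous_im.tendsto 0).comp hlim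
    have h2 : Tendsto (fun n => freq n ^ 2 + (β ^ 2 * η ^ 2 / 2 + γ - η ^ 2) / 2) atTop atTop :=
      tendsto_atTop_add_const_right _ _ ((tendsto_pow_atTop two_ne_zero).comp tendsto_freq)
    refine (h1.add_atTop h2).congr fun n => ?_
    have e : (-((β : ℂ) * (η : ℂ) + 1 / (κ : ℂ)) + Complex.I * ((Tube.freq n : ℂ) ^ 2
        + ((β : ℂ) ^ 2 * (η : ℂ) ^ 2 / 2 + (γ : ℂ) - (η : ℂ) ^ 2) / 2)) =
        ((-(β * η + 1 / κ) : ℝ) : ℂ) +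
          ((freq n ^ 2 + (β ^ 2 * η ^ 2 / 2 + γ - η ^ 2) / 2 : ℝ) : ℂ) * Complex.I := by
      push_cast; ring
    rw [Function.comp_apply, e, Complex.sub_im, Complex.add_im, Complex.ofReal_im,
      Complex.im_ofReal_mul, Complex.I_im]
    ring
  have hneg : -(β * η + 1 / κ) < 0 := by
    have h1 : 0 ≤ β * η := mul_nonneg hβ.1.le hη
    have h2 : 0 < 1 / κ := by positivity
    linarith
  obtain ⟨N₁, hN₁⟩ := eventually_atTop.1
    ((hre.eventually (gt_mem_nhds hneg)).and (him.eventually_gt_atTop 0))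
  set N := max N₀ N₁ with hN
  have hNN₀ : ∀ n, N ≤ n → N₀ ≤ n := fun n hn => (le_max_left _ _).trans hn
  have hNN₁ : ∀ n, N ≤ n → N₁ ≤ n := fun n hn => (le_max_right _ _).trans hn
  have hsimple : ∀ n, N ≤ n → IsSimpleEigenvalue β η γ κ (l n) := by
    intro n hn
    obtain ⟨h0, hd⟩ := hzero n (hNN₀ n hn)
    exact isSimpleEigenvalue_of_hasDerivAt h0 (differentiable_charDet _ _ _ _).hasDerivAt hd
  refine ⟨N, ρ, l, fun n => rfl, fun n hn => ⟨hsimple n hn, (hsimple n hn).conj,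
    (hN₁ n (hNN₁ n hn)).1, (hN₁ n (hNN₁ n hn)).2⟩, ?_, ?_, ?_, hasyl', hneg, hre, him⟩
  · intro n hn m hm hnm
    have hn0 := hNN₀ n hn
    have hm0 := hNN₀ m hm
    have hsq : ρ n ^ 2 = ρ m ^ 2 := mul_left_cancel₀ Complex.I_ne_zero hnm
    have heq : ρ n = ρ m := by
      refine (sq_eq_sq_iff_eq_or_eq_neg.1 hsq).resolve_right fun h => ?_
      have h1 := congrArg Complex.re h
      rw [Complex.neg_re] at h1
      linarith [(hreg n hn0).1, (hreg m hm0).1, hN₀ n hn0, hN₀ m hm0]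
    have hfr : freq n = freq m := by
      have h1 := (hρ n hn0).2
      rw [heq] at h1
      have h2 := h1.symm.trans (hρ m hm0).2
      exact_mod_cast add_right_cancel h2
    unfold freq at hfr
    have := mul_right_cancel₀ Real.pi_ne_zero hfr
    exact_mod_cast add_right_cancel this
  · set S : ℝ := max (max R R₀) (freq N + 1) + 1 with hS
    have hnz : ∃ a, charDet b g κ a ≠ 0 := by
      by_contra! h
      refine (hzero N₀ le_rfl).2 ?_
      have : charDet b g κ = fun _ => 0 := funext h
      rw [this]; simp
    obtain ⟨a, ha⟩ := hnz
    refine (finite_zeros_of_differentiable (differentiable_charDet b g κ) ha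
      ((2 * S) ^ 2)).subset ?_
    -- a large eigenvalue in the closed upper half-plane is one of the `l n`
    have hlarge : ∀ z : ℂ, IsEigenvalue β η γ κ z → 0 ≤ z.im → (2 * S) ^ 2 < ‖z‖ →
        ∃ n ≥ N, z = l n := by
      intro z hz hzim hzn
      obtain ⟨v, rfl, hv⟩ := exists_eq_I_mul_sq hzim
      have hdet : charDet b g κ (Complex.I * v ^ 2) = 0 := isEigenvalue_iff.1 hz
      have hS0 : 0 < S := by
        linarith [le_max_right (max R R₀) (freq N + 1), freq_pos N]
      have hvn : 2 * S < ‖v‖ := by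
        rw [norm_mul, Complex.norm_I, one_mul, norm_pow] at hzn
        exact lt_of_pow_lt_pow_left₀ 2 (norm_nonneg v) hzn
      have hvre : S < v.re := by
        have h1 := Complex.norm_le_abs_re_add_abs_im v
        rw [abs_of_nonneg ((abs_nonneg _).trans hv)] at h1
        linarith
      have hSR : R ≤ S := by
        linarith [le_max_left (max R R₀) (freq N + 1), le_max_left R R₀]
      have hSR₀ : R₀ ≤ S := by
        linarith [le_max_left (max R R₀) (freq N + 1), le_max_right R R₀]
      have hSN : freq N + 2 ≤ S := by linarith [le_max_right (max R R₀) (freq N + 1)]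
      have hvim : |v.im| ≤ Y := by
        have := hR₀ v (by linarith) hv hdet
        linarith [le_max_left Y₀ 0]
      obtain ⟨⟨hH, hfac⟩, -, hFv⟩ := hR v (by linarith) hvim
      rw [hdet, eq_comm, mul_eq_zero] at hfac
      obtain ⟨m, hm⟩ := exp_two_I_mul_eq_neg_one_iff.1
        (eq_neg_of_add_eq_zero_left (hfac.resolve_left hH))
      have hm' : v = (((m + 1 / 2) * Real.pi : ℝ) : ℂ) + F v := by
        push_cast; linear_combination hm
      have hmN : (N : ℝ) ≤ m := by
        have h1 := congrArg Complex.re hm'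
        rw [Complex.add_re, Complex.ofReal_re] at h1
        have h2 := (Complex.re_le_norm (F v)).trans hFv
        have h3 : freq N ≤ (m + 1 / 2) * Real.pi := by linarith
        unfold freq at h3
        have := le_of_mul_le_mul_right h3 Real.pi_pos
        linarith
      have hmN' : (N : ℤ) ≤ m := by exact_mod_cast hmN
      lift m to ℕ using (Int.natCast_nonneg N).trans hmN'
      have hNm : N ≤ m := by exact_mod_cast hmN'
      have hfm : (((m : ℤ) : ℝ) + 1 / 2) * Real.pi = freq m := by simp [freq]
      rw [hfm] at hm'
      have hm0 := hNN₀ m hNm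
      have hball : v ∈ Metric.closedBall (freq m : ℂ) 1 := by
        have e : v - freq m = F v := by linear_combination hm'
        rw [Metric.mem_closedBall, dist_eq_norm, e]
        linarith
      have hlip := norm_sub_le_of_ball hFR hY2 (by linarith [hN₀ m hm0]) (hρ m hm0).1 hball
      have e : F v - F (ρ m) = v - ρ m := by linear_combination (hρ m hm0).2 - hm'
      rw [e] at hlip
      have hvρ : v = ρ m := by
        rw [← sub_eq_zero, ← norm_le_zero_iff]
        linarith [norm_nonneg (v - ρ m)]
      exact ⟨m, hNm, by rw [hvρ]⟩
    intro z hz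
    refine ⟨isEigenvalue_iff.1 hz.1, ?_⟩
    by_contra! hzn
    rcases le_total 0 z.im with h | h
    · obtain ⟨n, hn, e⟩ := hlarge z hz.1 h hzn
      exact (hz.2 n hn).1 e
    · obtain ⟨n, hn, e⟩ := hlarge (starRingEnd ℂ z) hz.1.conj (by simpa using h)
        (by rwa [Complex.norm_conj])
      exact (hz.2 n hn).2 (by rw [← e, Complex.conj_conj])
  · refine hasy.congr_left fun n => ?_
    have hf : (freq n : ℂ) ≠ 0 := by exact_mod_cast (freq_pos n).ne'
    simp only [hb, hg]
    field_simp
    ring
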